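/- **Theorem 1.1.** Let $\Omega$ be a locally compact Hausdorff space with countable base, and let $\mathcal M^+(\Omega)$ be the class of nonnegative (locally finite) Radon measures on $\Omega$. Let $G\colon\Omega\times\Omega\to(0,+\infty]$ be a quasi-metric kernel with constant $\kappa>0$, that is, $G$ is lower semicontinuous, $G(x,y)=G(y,x)$, and $d=1/G$ satisfies $d(x,y)\le\kappa\,[d(x,z)+d(z,y)]$ for all $x,y,z\in\Omega$. Let $0<q<1$ and let $\mu,\sigma\in\mathcal M^+(\Omega)$ with $\sigma\ne0$. Notation. For $\nu\in\mathcal M^+(\Omega)$ put $\mathbf G\nu(x)=\int_\Omega G(x,y)\,d\nu(y)$ and $\|\nu\|=\nu(\Omega)$; similarly $\mathbf G(u^q d\sigma)(x)=\int_\Omega G(x,y)\,u(y)^q\,d\sigma(y)$. Put $B(x,r)=\{y\in\Omega: G(x,y)>1/r\}$ for $x\in\Omega$, $r>0$. For a Borel set $E\subset\Omega$ let $\varkappa(E)\in[0,\infty]$ be the least constant $C$ such that $\left(\int_E(\mathbf G\nu)^q\,d\sigma\right)^{1/q}\le C\,\|\nu\|$ for all $\nu\in\mathcal M^+(\Omega)$,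 and let $$\mathbf K\sigma(x)=\int_0^\infty\frac{[\varkappa(B(x,r))]^{\frac q{1-q}}}{r^2}\,dr .$$ Consider the equation $$u=\mathbf G(u^q\,d\sigma)+\mathbf G\mu\quad d\sigma\text{-a.e. in }\Omega .\tag{1}$$ A Borel function $u\colon\Omega\to[0,+\infty]$ is a *nontrivial supersolution* of (1) if $u>0$ and $\mathbf G(u^qd\sigma)+\mathbf G\mu\le u<+\infty$ $d\sigma$-a.e.; it is a *subsolution* if $u\le\mathbf G(u^qd\sigma)+\mathbf G\mu<+\infty$ $d\sigma$-a.e.; a *nontrivial solution* is both a subsolution and a nontrivial supersolution. There are positive constants $c,C$, depending only on $q$ and $\kappa$, such that the following statements hold. (i) Every nontrivial solution $u$ satisfies, for $d\sigma$-a.e. $x\in\Omega$, $$c\left[(\mathbf G\sigma(x))^{\frac1{1-q}}+\mathbf K\sigma(x)\right]+\mathbf G\mu(x)\le u(x)\tag{2}$$ and $$u(x)\le C\left[(\mathbf G\sigma(x))^{\frac1{1-q}}+\mathbf K\sigma(x)+\mathbf G\mu(x)\right].\tag{3}$$ Moreover, a nontrivial solution is unique: any two nontrivial solutions coincide $d\sigma$-a.e.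 (ii) If $u$ is a nontrivial supersolution, then (2) holds at every $x\in\Omega$ such that $u(x)\ge\mathbf G(u^qd\sigma)(x)+\mathbf G\mu(x)$. If $u$ is a subsolution, then (3) holds at every $x\in\Omega$ such that $u(x)\le\mathbf G(u^qd\sigma)(x)+\mathbf G\mu(x)$. (iii) The following are equivalent: a nontrivial solution of (1) exists; a nontrivial supersolution of (1) exists; the three conditions $$\int_a^\infty\frac{\sigma(B(x_0,r))}{r^2}\,dr<\infty,\qquad \int_a^\infty\frac{[\varkappa(B(x_0,r))]^{\frac q{1-q}}}{r^2}\,dr<\infty,\qquad \int_a^\infty\frac{\mu(B(x_0,r))}{r^2}\,dr<\infty$$ hold for some $x_0\in\Omega$ and $a>0$; these three conditions hold for all $x_0\in\Omega$ and $a>0$. Moreover, every nontrivial solution $u$ satisfies (2) and (3) at every $x\in\Omega$ such that $u(x)=\mathbf G(u^qd\sigma)(x)+\mathbf G\mu(x)$. -/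

import Mathlib

open MeasureTheory Set
open scoped ENNReal NNReal

noncomputable section

/-- `G` is a quasi-metric kernel with quasi-metric constant `κ`: a lower semicontinuous function
`Ω × Ω → (0, +∞]` that is symmetric and such that `d = 1 / G` satisfies the quasi-triangle
inequality with constant `κ` (with `1 / ∞ = 0`). -/
structure IsQuasiMetricKernel {Ω : Type*} [TopologicalSpace Ω]
    (G : Ω → Ω → ℝ≥0∞) (κ : ℝ≥0) : Prop where
  lowerSemicontinuous : LowerSemicontinuous (fun p : Ω × Ω => G p.1 p.2)
  pos : ∀ x y, 0 < G x y
  symm : ∀ x y, G x y = G y x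
  quasi_triangle : ∀ x y z, (G x y)⁻¹ ≤ (κ : ℝ≥0∞) * ((G x z)⁻¹ + (G z y)⁻¹)

/-- The potential `𝐆ν(x) = ∫ G(x, y) dν(y)`. -/
def kernelPotential {Ω : Type*} [MeasurableSpace Ω] (G : Ω → Ω → ℝ≥0∞) (ν : Measure Ω) (x : Ω) :
    ℝ≥0∞ :=
  ∫⁻ y, G x y ∂ν

/-- The ball `B(x, r) = {y | G(x, y) > 1 / r}`, used for `r > 0`. -/
def kernelBall {Ω : Type*} (G : Ω → Ω → ℝ≥0∞) (x : Ω) (r : ℝ) : Set Ω :=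
  {y | ENNReal.ofReal (1 / r) < G x y}

/-- The least constant `ϰ(E, σ) ∈ [0, ∞]` in the inequality
`‖𝐆ν‖_{L^q(Ω, σ_E)} ≤ C ‖ν‖` for all nonnegative Radon measures `ν`, where `‖ν‖ = ν(Ω)` and
`σ_E` is the restriction of `σ` to `E`. On a locally compact Hausdorff space with countable base,
the nonnegative Radon measures are the locally finite Borel measures. -/
def kappaConst {Ω : Type*} [TopologicalSpace Ω] [MeasurableSpace Ω] (G : Ω → Ω → ℝ≥0∞) (q : ℝ)
    (σ : Measure Ω) (E : Set Ω) : ℝ≥0∞ :=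
  sInf {C : ℝ≥0∞ | ∀ ν : Measure Ω, IsLocallyFiniteMeasure ν →
    (∫⁻ x, (kernelPotential G ν x) ^ q ∂(σ.restrict E)) ^ (1 / q) ≤ C * ν univ}

/-- The intrinsic nonlinear potential
`𝐊σ(x) = ∫_0^∞ ϰ(B(x, r))^{q/(1-q)} r⁻² dr`. -/
def intrinsicPotential {Ω : Type*} [TopologicalSpace Ω] [MeasurableSpace Ω] (G : Ω → Ω → ℝ≥0∞)
    (q : ℝ) (σ : Measure Ω) (x : Ω) : ℝ≥0∞ :=
  ∫⁻ r in Ioi (0 : ℝ), (kappaConst G q σ (kernelBall G x r)) ^ (q / (1 - q)) / ENNReal.ofReal (r ^ 2)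

/-- The right-hand side `𝐆(u^q dσ)(x) + 𝐆μ(x)` of the equation. -/
def sublinearRHS {Ω : Type*} [MeasurableSpace Ω] (G : Ω → Ω → ℝ≥0∞) (q : ℝ) (σ μ : Measure Ω)
    (u : Ω → ℝ≥0∞) (x : Ω) : ℝ≥0∞ :=
  kernelPotential G (σ.withDensity (fun y => u y ^ q)) x + kernelPotential G μ x

/-- A nontrivial supersolution of `u = 𝐆(u^q dσ) + 𝐆μ`. -/
structure IsNontrivialSupersolution {Ω : Type*} [MeasurableSpace Ω] (G : Ω → Ω → ℝ≥0∞) (q : ℝ)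
    (σ μ : Measure Ω) (u : Ω → ℝ≥0∞) : Prop where
  measurable : Measurable u
  pos : ∀ᵐ x ∂σ, 0 < u x
  rhs_le : ∀ᵐ x ∂σ, sublinearRHS G q σ μ u x ≤ u x
  lt_top : ∀ᵐ x ∂σ, u x < ∞

/-- A subsolution of `u = 𝐆(u^q dσ) + 𝐆μ`. -/
structure IsSubsolution {Ω : Type*} [MeasurableSpace Ω] (G : Ω → Ω → ℝ≥0∞) (q : ℝ)
    (σ μ : Measure Ω) (u : Ω → ℝ≥0∞) : Prop where
  measurable : Measurable u
  le_rhs : ∀ᵐ x ∂σ, u x ≤ sublinearRHS G q σ μ u x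
  rhs_lt_top : ∀ᵐ x ∂σ, sublinearRHS G q σ μ u x < ∞

/-- A nontrivial solution is both a subsolution and a nontrivial supersolution. -/
def IsNontrivialSolution {Ω : Type*} [MeasurableSpace Ω] (G : Ω → Ω → ℝ≥0∞) (q : ℝ)
    (σ μ : Measure Ω) (u : Ω → ℝ≥0∞) : Prop :=
  IsSubsolution G q σ μ u ∧ IsNontrivialSupersolution G q σ μ u

/-- The lower estimate `c [(𝐆σ(x))^{1/(1-q)} + 𝐊σ(x)] + 𝐆μ(x) ≤ u(x)`. -/
def LowerEstimateAt {Ω : Type*} [TopologicalSpace Ω] [MeasurableSpace Ω] (c : ℝ≥0)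
    (G : Ω → Ω → ℝ≥0∞) (q : ℝ) (σ μ : Measure Ω) (u : Ω → ℝ≥0∞) (x : Ω) : Prop :=
  (c : ℝ≥0∞) * ((kernelPotential G σ x) ^ (1 / (1 - q)) + intrinsicPotential G q σ x)
    + kernelPotential G μ x ≤ u x

/-- The upper estimate `u(x) ≤ C [(𝐆σ(x))^{1/(1-q)} + 𝐊σ(x) + 𝐆μ(x)]`. -/
def UpperEstimateAt {Ω : Type*} [TopologicalSpace Ω] [MeasurableSpace Ω] (C : ℝ≥0)
    (G : Ω → Ω → ℝ≥0∞) (q : ℝ) (σ μ : Measure Ω) (u : Ω → ℝ≥0∞) (x : Ω) : Prop :=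
  u x ≤ (C : ℝ≥0∞) * ((kernelPotential G σ x) ^ (1 / (1 - q)) + intrinsicPotential G q σ x
    + kernelPotential G μ x)

/-- The three integrals over `(a, ∞)` of `σ(B(x₀, r)) / r²`, `ϰ(B(x₀, r))^{q/(1-q)} / r²` and
`μ(B(x₀, r)) / r²` are finite. -/
def TailConditions {Ω : Type*} [TopologicalSpace Ω] [MeasurableSpace Ω] (G : Ω → Ω → ℝ≥0∞)
    (q : ℝ) (σ μ : Measure Ω) (x₀ : Ω) (a : ℝ) : Prop :=
  (∫⁻ r in Ioi a, σ (kernelBall G x₀ r) / ENNReal.ofReal (r ^ 2)) < ∞ ∧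
  (∫⁻ r in Ioi a,
    (kappaConst G q σ (kernelBall G x₀ r)) ^ (q / (1 - q)) / ENNReal.ofReal (r ^ 2)) < ∞ ∧
  (∫⁻ r in Ioi a, μ (kernelBall G x₀ r) / ENNReal.ofReal (r ^ 2)) < ∞

end

/-! Everything is read off from balls. By Tonelli, `𝐆ν(x)` is the integral of `ν(B(x, r)) / r²` over
`r > 0` (`kernelPotential_eq_tailIntegral`), so inequalities between quantities attached to balls
integrate to inequalities between potentials.

Lower bound. Let `ω = u^q dσ`, so that `𝐆ω ≤ u`. A Vitali covering gives a weak type bound for `𝐆ν /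
𝐆ω` with respect to `ω` (`weak_type`). Since `q < 1`, it upgrades to `ϰ(E)^{q/(1-q)} ≲ ω(E)`
(`kappaConst_rpow_le`), and `E = B(x, r)` yields `𝐊σ ≲ 𝐆ω`. For the power of `𝐆σ`, freeze `x` and
put `ρ = G(x, ·) ω`. The quasi-triangle inequality gives `Λ(y) = ρ{G(x, ·) ≤ G(x, y)} ≤ 2κ u(y)`,
while `∫ Λ^{-q} dρ ≲ ρ(Ω)^{1-q}` for any measure (`kernelPotential_rpow_le`).

Upper bound. Let `ω = u^q dσ + μ` and split it at `B(x, 2κr)`. On `B(x, r)` the near part is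
governed by `ϰ(B(x, r))` and the far part by the tail of `ω`. Young's inequality turns this into
half the tail of `ω` plus terms in the data (`tailIntegral_kernelPotential_rpow_le`). Tails from `ε
> 0` are finite, so the half is absorbed, and then `ε → 0`.

The two bounds make any two solutions comparable, and homogeneity of degree `q < 1` improves the
comparison constant to 1 (`ae_le_of_ae_le_const_mul`). For existence, monotone iteration starts from
a small subsolution, and the same absorption bounds all iterates uniformly (`exists_solution`). -/

/-! ### Calculus of tail integrals -/

/-- The tail integral `∫_a^∞ φ(r) r⁻² dr`. -/
noncomputable def tailIntegral (φ : ℝ → ℝ≥0∞) (a : ℝ) : ℝ≥0∞ :=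
  ∫⁻ r in Ioi a, φ r / ENNReal.ofReal (r ^ 2)

lemma tailIntegral_mono {φ ψ : ℝ → ℝ≥0∞} {a : ℝ} (h : ∀ r, a < r → φ r ≤ ψ r) :
    tailIntegral φ a ≤ tailIntegral ψ a :=
  setLIntegral_mono' measurableSet_Ioi fun r hr => ENNReal.div_le_div_right (h r hr) _

lemma tailIntegral_anti (φ : ℝ → ℝ≥0∞) : Antitone (tailIntegral φ) := fun _ _ h =>
  lintegral_mono_set (Ioi_subset_Ioi h)

lemma tailIntegral_scale (φ : ℝ → ℝ≥0∞) {c : ℝ} (hc : 0 < c) {a : ℝ} (ha : 0 ≤ a) :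
    tailIntegral (fun r => φ (c * r)) a = ENNReal.ofReal c * tailIntegral φ (c * a) := by
  have himg : (fun r : ℝ => c * r) '' Ioi a = Ioi (c * a) := by
    ext y
    simp only [mem_image, mem_Ioi]
    constructor
    · rintro ⟨r, hr, rfl⟩
      exact mul_lt_mul_of_pos_left hr hc
    · intro hy
      exact ⟨y / c, by rwa [lt_div_iff₀ hc, mul_comm], by field_simp⟩
  have h := lintegral_image_eq_lintegral_abs_deriv_mul (s := Ioi a) (f := fun r : ℝ => c * r)
    (f' := fun _ => c) measurableSet_Ioi
    (fun x _ => by simpa using ((hasDerivAt_id x).const_mul c).hasDerivWithinAt)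
    (fun x _ y _ hxy => mul_left_cancel₀ hc.ne' hxy) (fun r => φ r / ENNReal.ofReal (r ^ 2))
  rw [himg] at h
  unfold tailIntegral
  rw [h, ← lintegral_const_mul' _ _ ENNReal.ofReal_ne_top]
  refine setLIntegral_congr_fun measurableSet_Ioi fun r hr => ?_
  have hr0 : 0 < r := lt_of_le_of_lt ha hr
  have hc0 : ENNReal.ofReal c ≠ 0 := by simpa using hc
  simp only [abs_of_pos hc]
  rw [mul_pow, ENNReal.ofReal_mul (by positivity), pow_two c, ENNReal.ofReal_mul hc.le,
    ENNReal.div_eq_inv_mul, ENNReal.div_eq_inv_mul,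
    ENNReal.mul_inv (a := _ * _) (Or.inr ENNReal.ofReal_ne_top)
      (Or.inl (ENNReal.mul_ne_top ENNReal.ofReal_ne_top ENNReal.ofReal_ne_top)),
    ENNReal.mul_inv (by simp [hc0]) (by simp)]
  calc (ENNReal.ofReal (r ^ 2))⁻¹ * φ (c * r)
      = (ENNReal.ofReal c * (ENNReal.ofReal c)⁻¹) * (ENNReal.ofReal c * (ENNReal.ofReal c)⁻¹)
          * ((ENNReal.ofReal (r ^ 2))⁻¹ * φ (c * r)) := by
        rw [ENNReal.mul_inv_cancel hc0 ENNReal.ofReal_ne_top]; simp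
    _ = _ := by ring

lemma tailIntegral_le_of_le_scale {φ ψ : ℝ → ℝ≥0∞} {a b c : ℝ} (hc : 0 < c) (ha : 0 ≤ a)
    (hb : b ≤ c * a) (h : ∀ r, a < r → φ r ≤ ψ (c * r)) :
    tailIntegral φ a ≤ ENNReal.ofReal c * tailIntegral ψ b :=
  calc tailIntegral φ a ≤ tailIntegral (fun r => ψ (c * r)) a := tailIntegral_mono h
    _ = ENNReal.ofReal c * tailIntegral ψ (c * a) := tailIntegral_scale ψ hc ha
    _ ≤ _ := by gcongr; exact tailIntegral_anti ψ hb

lemma tailIntegral_const_mul (φ : ℝ → ℝ≥0∞) {c : ℝ≥0∞} (hc : c ≠ ∞) (a : ℝ) :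
    tailIntegral (fun r => c * φ r) a = c * tailIntegral φ a := by
  unfold tailIntegral
  rw [← lintegral_const_mul' _ _ hc]
  simp only [mul_div_assoc]

/-- Monotonicity supplies the measurability of one summand, which is all that additivity of the
lower integral needs. -/
lemma tailIntegral_add {φ : ℝ → ℝ≥0∞} (hφ : MonotoneOn φ (Ioi 0)) (ψ : ℝ → ℝ≥0∞) {a : ℝ}
    (ha : 0 ≤ a) :
    tailIntegral (fun r => φ r + ψ r) a = tailIntegral φ a + tailIntegral ψ a := by
  unfold tailIntegral
  simp only [ENNReal.add_div]
  refine lintegral_add_left' ?_ _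
  refine AEMeasurable.div ?_ (by fun_prop)
  exact aemeasurable_restrict_of_monotoneOn measurableSet_Ioi
    (hφ.mono (Ioi_subset_Ioi ha))

/-- Monotone convergence. It transfers to the full potential the bounds that are provable only for
positive lower limits, where the tails are finite. -/
lemma tailIntegral_zero_le {φ : ℝ → ℝ≥0∞} {Y : ℝ≥0∞} (h : ∀ ε, 0 < ε → tailIntegral φ ε ≤ Y) :
    tailIntegral φ 0 ≤ Y := by
  have hU : Ioi (0 : ℝ) = ⋃ n : ℕ, Ioi (1 / ((n : ℝ) + 1)) := by
    ext r
    simp only [mem_Ioi, mem_iUnion]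
    constructor
    · exact exists_nat_one_div_lt
    · rintro ⟨n, hn⟩
      exact lt_trans (by positivity) hn
  unfold tailIntegral
  rw [hU, setLIntegral_iUnion_of_directed]
  · exact iSup_le fun n => h _ (by positivity)
  · refine Monotone.directed_le fun m n hmn => Ioi_subset_Ioi ?_
    gcongr

lemma tailIntegral_one {a : ℝ} (ha : 0 ≤ a) :
    tailIntegral (fun _ => 1) a = (ENNReal.ofReal a)⁻¹ := by
  have hpos : ∀ a : ℝ, 0 < a → tailIntegral (fun _ => 1) a = (ENNReal.ofReal a)⁻¹ := by
    intro a ha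
    have h1 : tailIntegral (fun _ => 1) a = ∫⁻ r in Ioi a, ENNReal.ofReal (r ^ (-2 : ℝ)) := by
      refine setLIntegral_congr_fun measurableSet_Ioi fun r hr => ?_
      have hr0 : 0 < r := ha.trans hr
      simp only
      rw [one_div, ← ENNReal.ofReal_inv_of_pos (by positivity), Real.rpow_neg hr0.le]
      norm_num
    rw [h1, ← ofReal_integral_eq_lintegral_ofReal
      (integrableOn_Ioi_rpow_of_lt (by norm_num) ha)
      ((ae_restrict_iff' measurableSet_Ioi).2 (ae_of_all _ fun r hr =>
        Real.rpow_nonneg (ha.trans hr).le _)),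
      integral_Ioi_rpow_of_lt (by norm_num) ha, ← ENNReal.ofReal_inv_of_pos ha]
    congr 1
    norm_num [Real.rpow_neg_one]
  rcases ha.eq_or_lt with rfl | ha
  · simp only [ENNReal.ofReal_zero, ENNReal.inv_zero]
    refine ENNReal.eq_top_of_forall_nnreal_le fun t => ?_
    have ht : (0 : ℝ) < ((t : ℝ) + 1)⁻¹ := by positivity
    calc (t : ℝ≥0∞) ≤ ENNReal.ofReal (t + 1) := by
          rw [← ENNReal.ofReal_coe_nnreal]; exact ENNReal.ofReal_le_ofReal (by linarith)
      _ = tailIntegral (fun _ => 1) ((t : ℝ) + 1)⁻¹ := by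
          rw [hpos _ ht, ENNReal.ofReal_inv_of_pos (by positivity), inv_inv]
      _ ≤ _ := tailIntegral_anti _ ht.le
  · exact hpos a ha

/-! ### Two measure-theoretic inequalities -/

/-- The weak type bound `t ω{t < f} ≤ M` implies the strong bound for exponents `q < 1`. -/
lemma lintegral_rpow_le_of_weak_type {α : Type*} [MeasurableSpace α] (ω : Measure α) {q : ℝ}
    (hq0 : 0 < q) (hq1 : q < 1) {f : α → ℝ≥0∞} (hf : Measurable f) {M : ℝ≥0∞}
    (hω : ω univ ≠ ∞)
    (hM : ∀ t : ℝ, 0 < t → ENNReal.ofReal t * ω {x | ENNReal.ofReal t < f x} ≤ M) :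
    ∫⁻ x, f x ^ q ∂ω ≤ ENNReal.ofReal (1 / (1 - q)) * (M ^ q * ω univ ^ (1 - q)) := by
  have hq1' : 0 < 1 - q := by linarith
  rcases eq_or_ne (ω univ) 0 with h0 | h0
  · rw [Measure.measure_univ_eq_zero.1 h0]; simp
  rcases eq_or_ne M ∞ with rfl | hMtop
  · rw [ENNReal.top_rpow_of_pos hq0, ENNReal.top_mul, ENNReal.mul_top]
    · exact le_top
    · simpa using hq1
    · simp [h0, hω]
  rcases eq_or_ne M 0 with rfl | hM0
  · have hzero : ∀ᵐ x ∂ω, f x = 0 := by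
      have h : ∀ n : ℕ, ω {x | ENNReal.ofReal (1 / ((n : ℝ) + 1)) < f x} = 0 := fun n => by
        have h := hM (1 / ((n : ℝ) + 1)) (by positivity)
        rw [nonpos_iff_eq_zero, mul_eq_zero] at h
        refine h.resolve_left ?_
        simp only [ENNReal.ofReal_eq_zero, not_le]; positivity
      have h2 : ∀ᵐ x ∂ω, ∀ n : ℕ, ¬ (ENNReal.ofReal (1 / ((n : ℝ) + 1)) < f x) :=
        ae_all_iff.2 fun n => by rw [ae_iff]; simpa using h n
      filter_upwards [h2] with x hx
      by_contra hne
      obtain ⟨r, hr0, hr⟩ := ENNReal.lt_iff_exists_nnreal_btwn.1 (pos_iff_ne_zero.2 hne)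
      obtain ⟨n, hn⟩ := exists_nat_one_div_lt (show (0 : ℝ) < r by exact_mod_cast hr0)
      refine hx n (lt_of_le_of_lt ?_ hr)
      rw [← ENNReal.ofReal_coe_nnreal]
      exact ENNReal.ofReal_le_ofReal hn.le
    rw [lintegral_congr_ae (hzero.mono fun x hx => by rw [hx, ENNReal.zero_rpow_of_pos hq0])]
    simp
  have hfin : ∀ᵐ x ∂ω, f x ≠ ∞ := by
    rw [ae_iff]
    simp only [not_not]
    by_contra hne
    have key : ∀ n : ℕ, (n : ℝ≥0∞) * ω {x | f x = ∞} ≤ M := fun n => by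
      rcases Nat.eq_zero_or_pos n with rfl | hn
      · simp
      refine le_trans ?_ (hM n (by exact_mod_cast hn))
      rw [ENNReal.ofReal_natCast]
      gcongr
      intro hx; rw [hx]; simp
    have hle : (⊤ : ℝ≥0∞) ≤ M := by
      calc (⊤ : ℝ≥0∞) = (⨆ n : ℕ, (n : ℝ≥0∞)) * ω {x | f x = ∞} := by
            rw [ENNReal.iSup_natCast, ENNReal.top_mul hne]
        _ ≤ M := by rw [ENNReal.iSup_mul]; exact iSup_le key
    exact hMtop (top_le_iff.1 hle)
  have h1 : ∫⁻ x, f x ^ q ∂ω = ∫⁻ x, ENNReal.ofReal ((f x).toReal ^ q) ∂ω := by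
    refine lintegral_congr_ae (hfin.mono fun x hx => ?_)
    simp only
    rw [← ENNReal.ofReal_rpow_of_nonneg ENNReal.toReal_nonneg hq0.le, ENNReal.ofReal_toReal hx]
  have hset : ∀ t : ℝ, 0 < t → ω {x | t < (f x).toReal} ≤ ω {x | ENNReal.ofReal t < f x} := by
    intro t ht
    refine measure_mono fun x hx => ?_
    exact (ENNReal.ofReal_lt_iff_lt_toReal ht.le
      (fun h => by simp [h] at hx; linarith)).2 hx
  set m := (ω univ).toReal with hm
  set N := M.toReal with hN
  have hmpos : 0 < m := ENNReal.toReal_pos h0 hω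
  have hNpos : 0 < N := ENNReal.toReal_pos hM0 hMtop
  -- The two available bounds `m` and `N / t` for the distribution function cross at `t = s`.
  -- Splitting there makes both pieces multiples of `N^q m^{1-q}`.
  set s := N / m with hs
  have hspos : 0 < s := by positivity
  have hsmall : ∫⁻ t in Ioc 0 s, ω {x | t < (f x).toReal} * ENNReal.ofReal (t ^ (q - 1))
      ≤ ω univ * ENNReal.ofReal (s ^ q / q) := by
    calc _ ≤ ∫⁻ t in Ioc 0 s, ω univ * ENNReal.ofReal (t ^ (q - 1)) := by
          gcongr; exact subset_univ _
      _ = ω univ * ENNReal.ofReal (s ^ q / q) := by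
          rw [lintegral_const_mul' _ _ hω, ← ofReal_integral_eq_lintegral_ofReal]
          · rw [← intervalIntegral.integral_of_le hspos.le, integral_rpow (Or.inl (by linarith))]
            simp [Real.zero_rpow hq0.ne']
          · exact (intervalIntegrable_iff_integrableOn_Ioc_of_le hspos.le).1
              (intervalIntegral.intervalIntegrable_rpow' (by linarith))
          · exact (ae_restrict_iff' measurableSet_Ioc).2 (ae_of_all _ fun r hr =>
              Real.rpow_nonneg hr.1.le _)
  have hlarge : ∫⁻ t in Ioi s, ω {x | t < (f x).toReal} * ENNReal.ofReal (t ^ (q - 1))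
      ≤ M * ENNReal.ofReal (s ^ (q - 1) / (1 - q)) := by
    calc _ ≤ ∫⁻ t in Ioi s, M * ENNReal.ofReal (t ^ (q - 2)) := by
          refine setLIntegral_mono' measurableSet_Ioi fun t ht => ?_
          have ht0 : 0 < t := hspos.trans ht
          have : t ^ (q - 1) = t * t ^ (q - 2) := by
            rw [show q - 1 = 1 + (q - 2) by ring, Real.rpow_add ht0, Real.rpow_one]
          rw [this, ENNReal.ofReal_mul ht0.le, ← mul_assoc]
          gcongr
          rw [mul_comm]
          exact (mul_le_mul_right (hset t ht0) _).trans (hM t ht0)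
      _ = M * ENNReal.ofReal (s ^ (q - 1) / (1 - q)) := by
          rw [lintegral_const_mul' _ _ hMtop, ← ofReal_integral_eq_lintegral_ofReal
            (integrableOn_Ioi_rpow_of_lt (by linarith) hspos)
            ((ae_restrict_iff' measurableSet_Ioi).2 (ae_of_all _ fun r hr =>
              Real.rpow_nonneg (hspos.trans hr).le _)),
            integral_Ioi_rpow_of_lt (by linarith) hspos]
          congr 2
          rw [show q - 2 + 1 = q - 1 by ring, neg_div, ← div_neg, neg_sub]
  have hMN : M = ENNReal.ofReal N := (ENNReal.ofReal_toReal hMtop).symm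
  have hωm : ω univ = ENNReal.ofReal m := (ENNReal.ofReal_toReal hω).symm
  rw [h1, lintegral_rpow_eq_lintegral_meas_lt_mul ω (ae_of_all _ fun x => ENNReal.toReal_nonneg)
    hf.ennreal_toReal.aemeasurable hq0, ← Ioc_union_Ioi_eq_Ioi hspos.le,
    lintegral_union measurableSet_Ioi (Ioc_disjoint_Ioi le_rfl)]
  refine (mul_le_mul_right (add_le_add hsmall hlarge) _).trans ?_
  rw [hMN, hωm, ENNReal.ofReal_rpow_of_pos hNpos, ENNReal.ofReal_rpow_of_pos hmpos,
    ← ENNReal.ofReal_mul hmpos.le, ← ENNReal.ofReal_mul hNpos.le,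
    ← ENNReal.ofReal_add (by positivity) (by positivity), ← ENNReal.ofReal_mul hq0.le,
    ← ENNReal.ofReal_mul (by positivity), ← ENNReal.ofReal_mul (by positivity)]
  refine ENNReal.ofReal_le_ofReal (le_of_eq ?_)
  have e1 : m * s ^ q = N ^ q * m ^ (1 - q) := by
    rw [hs, Real.div_rpow hNpos.le hmpos.le, Real.rpow_sub hmpos, Real.rpow_one]
    field_simp
  have e2 : N * s ^ (q - 1) = N ^ q * m ^ (1 - q) := by
    rw [hs, Real.div_rpow hNpos.le hmpos.le, Real.rpow_sub hNpos, Real.rpow_one,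
      show q - 1 = -(1 - q) by ring, Real.rpow_neg hmpos.le]
    field_simp
  calc q * (m * (s ^ q / q) + N * (s ^ (q - 1) / (1 - q)))
      = (m * s ^ q) + q / (1 - q) * (N * s ^ (q - 1)) := by field_simp
    _ = _ := by rw [e1, e2]; field_simp; ring

/-- The sublevel distribution bound `ρ{x | ρ{g ≤ g x} < s} ≤ s`. -/
lemma measure_setOf_measure_le_lt_le {α : Type*} [MeasurableSpace α] (ρ : Measure α)
    (g : α → ℝ≥0∞) (s : ℝ≥0∞) : ρ {x | ρ {y | g y ≤ g x} < s} ≤ s := by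
  set S := {x | ρ {y | g y ≤ g x} < s} with hS
  rcases S.eq_empty_or_nonempty with h | hne
  · rw [h]; simp
  have hlub := isLUB_sSup (g '' S)
  -- If the supremum of `g` on `S` is attained at `x`, then `S` lies in the single sublevel set `{g
  -- ≤ g x}`. Otherwise `S` lies in an increasing union of such sets.
  by_cases hmem : sSup (g '' S) ∈ g '' S
  · obtain ⟨x, hx, hgx⟩ := hmem
    refine le_trans (measure_mono fun y hy => ?_) (le_of_lt hx)
    simp only [mem_ofPred_eq, hgx]
    exact le_sSup (mem_image_of_mem g hy)
  · obtain ⟨u, humono, -, hulim, humem⟩ := hlub.exists_seq_monotone_tendsto (hne.image g)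
    have hsub : S ⊆ ⋃ n, {y | g y ≤ u n} := fun y hy => by
      have hlt : g y < sSup (g '' S) := lt_of_le_of_ne (le_sSup (mem_image_of_mem g hy))
        fun h => hmem (h ▸ mem_image_of_mem g hy)
      obtain ⟨n, hn⟩ := (hulim.eventually (lt_mem_nhds hlt)).exists
      exact mem_iUnion.2 ⟨n, le_of_lt hn⟩
    refine (measure_mono hsub).trans ?_
    rw [Monotone.measure_iUnion (s := fun n => {y | g y ≤ u n})
      fun m n hmn y (hy : g y ≤ u m) => le_trans hy (humono hmn)]
    refine iSup_le fun n => ?_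
    obtain ⟨x, hx, hgx⟩ := humem n
    rw [← hgx]
    exact le_of_lt hx

/-! ### Quasi-metric balls, the layer-cake formula and the weak type inequality -/

/-- The quasi-metric `d = 1 / G`, as a real number. -/
noncomputable def kernelDist {Ω : Type*} (G : Ω → Ω → ℝ≥0∞) (x y : Ω) : ℝ := ((G x y)⁻¹).toReal

lemma kernelDist_nonneg {Ω : Type*} {G : Ω → Ω → ℝ≥0∞} (x y : Ω) : 0 ≤ kernelDist G x y :=
  ENNReal.toReal_nonneg

namespace IsQuasiMetricKernel

variable {Ω : Type*} [TopologicalSpace Ω] {G : Ω → Ω → ℝ≥0∞} {κ : ℝ≥0}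

lemma mono {κ' : ℝ≥0} (hG : IsQuasiMetricKernel G κ) (h : κ ≤ κ') : IsQuasiMetricKernel G κ' where
  lowerSemicontinuous := hG.lowerSemicontinuous
  pos := hG.pos
  symm := hG.symm
  quasi_triangle x y z := (hG.quasi_triangle x y z).trans (by gcongr)

lemma inv_ne_top (hG : IsQuasiMetricKernel G κ) (x y : Ω) : (G x y)⁻¹ ≠ ∞ := by
  simpa using (hG.pos x y).ne'

lemma ofReal_kernelDist (hG : IsQuasiMetricKernel G κ) (x y : Ω) :
    ENNReal.ofReal (kernelDist G x y) = (G x y)⁻¹ := ENNReal.ofReal_toReal (hG.inv_ne_top x y)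

lemma eq_inv_kernelDist (hG : IsQuasiMetricKernel G κ) (x y : Ω) :
    G x y = (ENNReal.ofReal (kernelDist G x y))⁻¹ := by rw [hG.ofReal_kernelDist, inv_inv]

lemma kernelDist_comm (hG : IsQuasiMetricKernel G κ) (x y : Ω) :
    kernelDist G x y = kernelDist G y x := by rw [kernelDist, hG.symm, kernelDist]

lemma kernelDist_triangle (hG : IsQuasiMetricKernel G κ) (x y z : Ω) :
    kernelDist G x y ≤ κ * (kernelDist G x z + kernelDist G z y) := by
  have h := hG.quasi_triangle x y z
  rw [← hG.ofReal_kernelDist, ← hG.ofReal_kernelDist, ← hG.ofReal_kernelDist,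
    ← ENNReal.ofReal_add (kernelDist_nonneg _ _) (kernelDist_nonneg _ _),
    ← ENNReal.ofReal_coe_nnreal, ← ENNReal.ofReal_mul κ.coe_nonneg] at h
  exact (ENNReal.ofReal_le_ofReal_iff (mul_nonneg κ.coe_nonneg
    (add_nonneg (kernelDist_nonneg _ _) (kernelDist_nonneg _ _)))).1 h

lemma mem_kernelBall (hG : IsQuasiMetricKernel G κ) {x y : Ω} {r : ℝ} (hr : 0 < r) :
    y ∈ kernelBall G x r ↔ kernelDist G x y < r := by
  change ENNReal.ofReal (1 / r) < G x y ↔ _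
  rw [one_div, ENNReal.ofReal_inv_of_pos hr, ENNReal.inv_lt_iff_inv_lt, ← hG.ofReal_kernelDist,
    ENNReal.ofReal_lt_ofReal_iff hr]

lemma le_mul_of_kernelDist_le (hG : IsQuasiMetricKernel G κ) {x y z w : Ω} {c : ℝ} (hc : 0 < c)
    (h : kernelDist G z w ≤ c * kernelDist G x y) : G x y ≤ ENNReal.ofReal c * G z w := by
  rw [hG.eq_inv_kernelDist x y, hG.eq_inv_kernelDist z w, ENNReal.inv_le_iff_inv_le,
    ENNReal.mul_inv (by simp [hc]) (by simp), inv_inv, ← ENNReal.ofReal_inv_of_pos hc,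
    ← ENNReal.ofReal_mul (by positivity)]
  refine ENNReal.ofReal_le_ofReal ?_
  rw [inv_mul_le_iff₀ hc]
  exact h

lemma kernelDist_anti (hG : IsQuasiMetricKernel G κ) {x y z w : Ω} (h : G x y ≤ G z w) :
    kernelDist G z w ≤ kernelDist G x y :=
  ENNReal.toReal_mono (hG.inv_ne_top _ _) (ENNReal.inv_le_inv.2 h)

lemma kernelBall_mono (hG : IsQuasiMetricKernel G κ) (x : Ω) :
    MonotoneOn (kernelBall G x) (Ioi 0) := fun _ hr _ hs hrs _ hy =>
  (hG.mem_kernelBall hs).2 (((hG.mem_kernelBall hr).1 hy).trans_le hrs)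

lemma kernelBall_subset (hG : IsQuasiMetricKernel G κ) (hκ : 1 ≤ κ) (x x₀ : Ω) {r s : ℝ}
    (hr : 0 < r) (hs : κ * (kernelDist G x₀ x + r) ≤ s) :
    kernelBall G x r ⊆ kernelBall G x₀ s := by
  have hκ' : (1 : ℝ) ≤ κ := by exact_mod_cast hκ
  have hd := kernelDist_nonneg (G := G) x₀ x
  have hs0 : 0 < s := lt_of_lt_of_le (by positivity) hs
  intro y hy
  rw [hG.mem_kernelBall hr] at hy
  rw [hG.mem_kernelBall hs0]
  refine lt_of_le_of_lt (hG.kernelDist_triangle x₀ y x) (lt_of_lt_of_le ?_ hs)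
  gcongr

/-- For `y ∈ B(x, r)`, the kernel `G(y, ·)` off `B(x, 2κr)` is controlled by `G(x, ·)`. -/
lemma le_of_notMem_kernelBall (hG : IsQuasiMetricKernel G κ) (hκ : 1 ≤ κ) {x y z : Ω} {r : ℝ}
    (hr : 0 < r) (hy : y ∈ kernelBall G x r) (hz : z ∉ kernelBall G x (2 * κ * r)) :
    G y z ≤ ENNReal.ofReal (2 * κ) * min (ENNReal.ofReal r)⁻¹ (G x z) := by
  have hκ' : (1 : ℝ) ≤ κ := by exact_mod_cast hκ
  rw [hG.mem_kernelBall hr] at hy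
  rw [hG.mem_kernelBall (by positivity), not_lt] at hz
  have h := hG.kernelDist_triangle x z y
  -- Here `κ d(x, y) < κr ≤ d(x, z) / 2`, so this term is absorbed on the left.
  have hle : kernelDist G x z ≤ 2 * κ * kernelDist G y z := by nlinarith
  have h1 := hG.le_mul_of_kernelDist_le (by positivity) hle
  rw [min_eq_right]
  · exact h1
  · rw [hG.eq_inv_kernelDist]
    refine ENNReal.inv_le_inv.2 (ENNReal.ofReal_le_ofReal (le_trans ?_ hz))
    nlinarith

/-- If `z` is at least as far from `x` as `y` is, then `d(y, z) ≤ κ (d(y, x) + d(x, z)) ≤ 2κ d(x,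
z)`. -/
lemma le_mul_of_le (hG : IsQuasiMetricKernel G κ) (hκ : 1 ≤ κ) {x y z : Ω} (h : G x z ≤ G x y) :
    G x z ≤ ENNReal.ofReal (2 * κ) * G y z := by
  have hκ' : (1 : ℝ) ≤ κ := by exact_mod_cast hκ
  refine hG.le_mul_of_kernelDist_le (by positivity) ?_
  have h1 := hG.kernelDist_anti h
  have h2 := hG.kernelDist_triangle y z x
  rw [hG.kernelDist_comm y x] at h2
  nlinarith

lemma isOpen_kernelBall (hG : IsQuasiMetricKernel G κ) (x : Ω) (r : ℝ) :
    IsOpen (kernelBall G x r) := by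
  have : LowerSemicontinuous (G x) :=
    hG.lowerSemicontinuous.comp (Continuous.prodMk_right x)
  exact this.isOpen_preimage _

lemma measurableSet_kernelBall [MeasurableSpace Ω] [BorelSpace Ω] (hG : IsQuasiMetricKernel G κ)
    (x : Ω) (r : ℝ) : MeasurableSet (kernelBall G x r) :=
  (hG.isOpen_kernelBall x r).measurableSet

lemma measure_kernelBall_mono [MeasurableSpace Ω] (hG : IsQuasiMetricKernel G κ) (ν : Measure Ω)
    (x : Ω) : MonotoneOn (fun r => ν (kernelBall G x r)) (Ioi 0) := fun _ hr _ hs hrs =>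
  measure_mono (hG.kernelBall_mono x hr hs hrs)

variable [SecondCountableTopology Ω] [MeasurableSpace Ω] [BorelSpace Ω]

lemma measurable (hG : IsQuasiMetricKernel G κ) : Measurable (fun p : Ω × Ω => G p.1 p.2) :=
  hG.lowerSemicontinuous.measurable

lemma measurable_right (hG : IsQuasiMetricKernel G κ) (x : Ω) : Measurable (G x) :=
  hG.measurable.comp measurable_prodMk_left

lemma measurable_kernelPotential (hG : IsQuasiMetricKernel G κ) (ν : Measure Ω) [SFinite ν] :
    Measurable (kernelPotential G ν) :=
  hG.measurable.lintegral_prod_right'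

/-- Tonelli: a point `z` contributes the integral of `r⁻²` over `r > max(a, d(x, z))`, which is the
truncated kernel. This truncation is the one bounding the far part in `le_of_notMem_kernelBall`. -/
lemma tailIntegral_measure_kernelBall (hG : IsQuasiMetricKernel G κ) (ν : Measure Ω) [SFinite ν]
    (x : Ω) {a : ℝ} (ha : 0 ≤ a) :
    tailIntegral (fun r => ν (kernelBall G x r)) a
      = ∫⁻ z, min (ENNReal.ofReal a)⁻¹ (G x z) ∂ν := by
  set s : Set (ℝ × Ω) := {p | ENNReal.ofReal (1 / p.1) < G x p.2} with hs
  have hsm : MeasurableSet s :=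
    measurableSet_lt (by fun_prop) ((hG.measurable_right x).comp measurable_snd)
  have h1 : tailIntegral (fun r => ν (kernelBall G x r)) a
      = ∫⁻ r in Ioi a, ∫⁻ z, s.indicator (fun p => (ENNReal.ofReal (p.1 ^ 2))⁻¹) (r, z) ∂ν := by
    refine setLIntegral_congr_fun measurableSet_Ioi fun r _ => ?_
    have : (fun z => s.indicator (fun p => (ENNReal.ofReal (p.1 ^ 2))⁻¹) (r, z))
        = (kernelBall G x r).indicator (fun _ => (ENNReal.ofReal (r ^ 2))⁻¹) := rfl
    simp only [this]
    rw [lintegral_indicator (hG.measurableSet_kernelBall x r), setLIntegral_const,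
      ENNReal.div_eq_inv_mul]
  rw [h1, lintegral_lintegral_swap
    (f := fun r z => s.indicator (fun p => (ENNReal.ofReal (p.1 ^ 2))⁻¹) (r, z))
    (Measurable.aemeasurable
    (Measurable.indicator (by fun_prop) hsm))]
  refine lintegral_congr fun z => ?_
  have hd := kernelDist_nonneg (G := G) x z
  have h2 : ∫⁻ r in Ioi a, s.indicator (fun p => (ENNReal.ofReal (p.1 ^ 2))⁻¹) (r, z)
      = ∫⁻ r in Ioi a, (Ioi (kernelDist G x z)).indicator
          (fun r => 1 / ENNReal.ofReal (r ^ 2)) r := by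
    refine setLIntegral_congr_fun measurableSet_Ioi fun r hr => ?_
    have hr0 : 0 < r := lt_of_le_of_lt ha hr
    have hiff : (r, z) ∈ s ↔ r ∈ Ioi (kernelDist G x z) := hG.mem_kernelBall hr0
    simp only [indicator_apply, hiff, one_div]
  rw [h2, setLIntegral_indicator measurableSet_Ioi, Ioi_inter_Ioi]
  refine (tailIntegral_one (le_max_of_le_right ha)).trans ?_
  rw [hG.eq_inv_kernelDist x z, ENNReal.ofReal_max]
  rcases le_total (kernelDist G x z) a with h | h
  · rw [max_eq_right (ENNReal.ofReal_le_ofReal h),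
      min_eq_left (ENNReal.inv_le_inv.2 (ENNReal.ofReal_le_ofReal h))]
  · rw [max_eq_left (ENNReal.ofReal_le_ofReal h),
      min_eq_right (ENNReal.inv_le_inv.2 (ENNReal.ofReal_le_ofReal h))]

lemma kernelPotential_eq_tailIntegral (hG : IsQuasiMetricKernel G κ) (ν : Measure Ω) [SFinite ν]
    (x : Ω) : kernelPotential G ν x = tailIntegral (fun r => ν (kernelBall G x r)) 0 := by
  rw [hG.tailIntegral_measure_kernelBall ν x le_rfl]
  simp [kernelPotential]

/-- The weak type estimate for the quotient of two potentials. -/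
lemma weak_type (hG : IsQuasiMetricKernel G κ) (hκ : 1 ≤ κ) (ν ω : Measure Ω) [SFinite ν]
    [SFinite ω] (t : ℝ) :
    ENNReal.ofReal t * ω {y | ENNReal.ofReal t * kernelPotential G ω y < kernelPotential G ν y}
      ≤ ENNReal.ofReal (3 * κ) * ν univ := by
  have hκ' : (1 : ℝ) ≤ κ := by exact_mod_cast hκ
  have h3 : (0 : ℝ) < 3 * κ := by positivity
  -- The Vitali lemma needs bounded radii, hence the exhaustion by `n`.
  let E : ℕ → Set Ω := fun n => {y | ∃ r : ℝ, 0 < r ∧ r ≤ n ∧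
    ENNReal.ofReal t * ω (kernelBall G y (3 * κ * r))
      < ENNReal.ofReal (3 * κ) * ν (kernelBall G y r)}
  have hmono : Monotone E := fun m n hmn y ⟨r, h0, h1, h2⟩ =>
    ⟨r, h0, h1.trans (by exact_mod_cast hmn), h2⟩
  have hsub : {y | ENNReal.ofReal t * kernelPotential G ω y < kernelPotential G ν y}
      ⊆ ⋃ n, E n := by
    intro y hy
    have hex : ∃ r : ℝ, 0 < r ∧ ENNReal.ofReal t * ω (kernelBall G y (3 * κ * r))
        < ENNReal.ofReal (3 * κ) * ν (kernelBall G y r) := by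
      -- If no radius worked, integrating the reverse inequality against `r⁻² dr` would produce the
      -- factor `3κ` on both sides (on the left by scaling), giving `t 𝐆ω(y) ≥ 𝐆ν(y)`.
      by_contra! hcon
      have hint := tailIntegral_mono (a := 0) hcon
      rw [tailIntegral_const_mul _ ENNReal.ofReal_ne_top,
        tailIntegral_const_mul _ ENNReal.ofReal_ne_top,
        tailIntegral_scale (fun r => ω (kernelBall G y r)) h3 le_rfl, mul_zero,
        ← hG.kernelPotential_eq_tailIntegral, ← hG.kernelPotential_eq_tailIntegral,
        ← mul_assoc, mul_comm (ENNReal.ofReal t), mul_assoc,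
        ENNReal.mul_le_mul_iff_right (by simpa using (one_pos.trans_le hκ).ne')
          ENNReal.ofReal_ne_top] at hint
      exact absurd hy (not_lt.2 hint)
    obtain ⟨r, hr0, hr⟩ := hex
    obtain ⟨n, hn⟩ := exists_nat_ge r
    exact mem_iUnion.2 ⟨n, r, hr0, hn, hr⟩
  have hE : ∀ n, ENNReal.ofReal t * ω (E n) ≤ ENNReal.ofReal (3 * κ) * ν univ := by
    intro n
    choose! ρ hρ0 hρn hρ using fun y (hy : y ∈ E n) => hy
    have hne : ∀ a ∈ E n, (kernelBall G a (ρ a)).Nonempty := fun a ha => by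
      by_contra hemp
      rw [not_nonempty_iff_eq_empty] at hemp
      have := hρ a ha
      simp [hemp] at this
    obtain ⟨s, hsE, hdisj, hs⟩ := Vitali.exists_disjoint_subfamily_covering_enlargement
      (fun a => kernelBall G a (ρ a)) (E n) ρ 2 one_lt_two (fun a ha => (hρ0 a ha).le) n hρn hne
    have hcount : s.Countable := hdisj.countable_of_isOpen
      (fun a _ => hG.isOpen_kernelBall a _) fun a ha => hne a (hsE ha)
    -- Only the centers have to be covered: with `ρ a ≤ 2 ρ b` and intersecting balls, `d(b, a) < κ
    -- (ρ b + ρ a) ≤ 3κ ρ b`.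
    have hcover : E n ⊆ ⋃ b ∈ s, kernelBall G b (3 * κ * ρ b) := by
      intro a ha
      obtain ⟨b, hb, ⟨z, hza, hzb⟩, hab⟩ := hs a ha
      refine mem_iUnion₂.2 ⟨b, hb, ?_⟩
      have hb0 := hρ0 b (hsE hb)
      rw [hG.mem_kernelBall (hρ0 a ha)] at hza
      rw [hG.mem_kernelBall hb0] at hzb
      rw [hG.mem_kernelBall (by positivity)]
      have h := hG.kernelDist_triangle b a z
      rw [hG.kernelDist_comm z a] at h
      nlinarith
    calc ENNReal.ofReal t * ω (E n)
        ≤ ENNReal.ofReal t * ∑' b : s, ω (kernelBall G b (3 * κ * ρ b)) := by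
          gcongr
          exact (measure_mono hcover).trans (measure_biUnion_le ω hcount _)
      _ = ∑' b : s, ENNReal.ofReal t * ω (kernelBall G b (3 * κ * ρ b)) :=
          ENNReal.tsum_mul_left.symm
      _ ≤ ∑' b : s, ENNReal.ofReal (3 * κ) * ν (kernelBall G b (ρ b)) :=
          ENNReal.tsum_le_tsum fun b => (hρ b (hsE b.2)).le
      _ = ENNReal.ofReal (3 * κ) * ν (⋃ b ∈ s, kernelBall G b (ρ b)) := by
          rw [ENNReal.tsum_mul_left, measure_biUnion hcount hdisj
            fun b _ => hG.measurableSet_kernelBall b _]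
      _ ≤ _ := by gcongr; exact subset_univ _
  calc _ ≤ ENNReal.ofReal t * ω (⋃ n, E n) := by gcongr
    _ = ⨆ n, ENNReal.ofReal t * ω (E n) := by rw [hmono.measure_iUnion, ENNReal.mul_iSup]
    _ ≤ _ := iSup_le hE

end IsQuasiMetricKernel

/-! ### The constant `ϰ` and the lower bounds for supersolutions -/

section KappaConst

variable {Ω : Type*} [TopologicalSpace Ω] [MeasurableSpace Ω] {G : Ω → Ω → ℝ≥0∞} {q : ℝ}
  {σ : Measure Ω}

lemma kappaConst_mono {E F : Set Ω} (hq0 : 0 < q) (h : E ⊆ F) :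
    kappaConst G q σ E ≤ kappaConst G q σ F :=
  sInf_le_sInf fun _ hC ν hν => le_trans (by gcongr) (hC ν hν)

/-- The infimum defining `kappaConst` is itself admissible, as division by a finite nonzero mass
shows; the zero measure is trivial. -/
lemma lintegral_kernelPotential_rpow_le (hq0 : 0 < q) (E : Set Ω) (ν : Measure Ω)
    (hν : ν univ ≠ ∞) :
    ∫⁻ x in E, kernelPotential G ν x ^ q ∂σ ≤ kappaConst G q σ E ^ q * ν univ ^ q := by
  rcases eq_or_ne (ν univ) 0 with h0 | h0
  · rw [Measure.measure_univ_eq_zero.1 h0]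
    simp [kernelPotential, ENNReal.zero_rpow_of_pos hq0]
  have hfin : IsFiniteMeasure ν := ⟨hν.lt_top⟩
  have h : (∫⁻ x in E, kernelPotential G ν x ^ q ∂σ) ^ (1 / q)
      ≤ kappaConst G q σ E * ν univ := by
    rw [← ENNReal.div_le_iff h0 hν]
    exact le_sInf fun C hC => by
      rw [ENNReal.div_le_iff h0 hν]
      exact hC ν inferInstance
  rwa [one_div, ENNReal.rpow_inv_le_iff hq0, ENNReal.mul_rpow_of_nonneg _ _ hq0.le] at h

end KappaConst

namespace IsQuasiMetricKernel

variable {Ω : Type*} [TopologicalSpace Ω] {G : Ω → Ω → ℝ≥0∞} {κ : ℝ≥0}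
  [SecondCountableTopology Ω] [MeasurableSpace Ω] [BorelSpace Ω] {q : ℝ} {σ : Measure Ω}

/-- A positive supersolution `u` of `u ≥ 𝐆(u^q dσ)` bounds the constant of the restricted
weighted norm inequality. -/
lemma kappaConst_rpow_le (hG : IsQuasiMetricKernel G κ) (hκ : 1 ≤ κ) (hq0 : 0 < q) (hq1 : q < 1)
    [SFinite σ] {u : Ω → ℝ≥0∞} (hum : Measurable u) (hpos : ∀ᵐ x ∂σ, 0 < u x)
    (hlt : ∀ᵐ x ∂σ, u x < ∞)
    (hsup : ∀ᵐ x ∂σ, kernelPotential G (σ.withDensity fun y => u y ^ q) x ≤ u x)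
    {E : Set Ω} (hE : MeasurableSet E) :
    kappaConst G q σ E ^ (q / (1 - q))
      ≤ (ENNReal.ofReal (1 / (1 - q)) ^ (1 / q) * ENNReal.ofReal (3 * κ)) ^ (q / (1 - q))
        * ∫⁻ x in E, u x ^ q ∂σ := by
  have hq1' : 0 < 1 - q := by linarith
  have hκ' : (1 : ℝ) ≤ κ := by exact_mod_cast hκ
  set A := ENNReal.ofReal (1 / (1 - q)) with hA
  set m := ∫⁻ x in E, u x ^ q ∂σ with hm
  have hA0 : A ≠ 0 := by simp [hA, hq1]
  have hB0 : A ^ (1 / q) * ENNReal.ofReal (3 * κ) ≠ 0 := by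
    refine mul_ne_zero (ENNReal.rpow_pos (pos_iff_ne_zero.2 hA0) ENNReal.ofReal_ne_top).ne' ?_
    simp only [ne_eq, ENNReal.ofReal_eq_zero, not_le]; positivity
  rcases eq_or_ne m ∞ with hmtop | hmtop
  · rw [hmtop, ENNReal.mul_top]
    · exact le_top
    · rw [ne_eq, ENNReal.rpow_eq_zero_iff]
      have : 0 < q / (1 - q) := by positivity
      rintro (⟨h, -⟩ | ⟨-, h⟩)
      · exact hB0 h
      · linarith
  have huq : Measurable fun y => u y ^ q := hum.pow_const q
  set ω := (σ.restrict E).withDensity fun y => u y ^ q with hω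
  have hωuniv : ω univ = m := by rw [hω, withDensity_apply _ MeasurableSet.univ]; simp [hm]
  have hac : ∀ {p : Ω → Prop}, (∀ᵐ x ∂σ, p x) → ∀ᵐ x ∂ω, p x := fun h =>
    (withDensity_absolutelyContinuous _ _).ae_le (ae_restrict_of_ae h)
  have hωle : ω ≤ σ.withDensity fun y => u y ^ q := by
    rw [hω, ← restrict_withDensity hE]; exact Measure.restrict_le_self
  have hmain : kappaConst G q σ E ≤ A ^ (1 / q) * ENNReal.ofReal (3 * κ) * m ^ ((1 - q) / q) := by
    refine sInf_le fun ν hν => ?_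
    have hνm := hG.measurable_kernelPotential ν
    have hfm : Measurable fun x => kernelPotential G ν x / u x := hνm.div hum
    have h1 : ∫⁻ x in E, kernelPotential G ν x ^ q ∂σ
        = ∫⁻ x, (kernelPotential G ν x / u x) ^ q ∂ω := by
      rw [hω, lintegral_withDensity_eq_lintegral_mul _ huq (hfm.pow_const q)]
      refine lintegral_congr_ae (ae_restrict_of_ae ?_)
      filter_upwards [hpos, hlt] with x hx0 hx1
      simp only [Pi.mul_apply]
      rw [← ENNReal.mul_rpow_of_nonneg _ _ hq0.le, ENNReal.mul_div_cancel hx0.ne' hx1.ne]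
    have h2 := lintegral_rpow_le_of_weak_type ω hq0 hq1 hfm
      -- Since `𝐆ω ≤ u` almost everywhere, `{𝐆ν / u > t}` is contained, up to a null set, in `{𝐆ν >
      -- t 𝐆ω}`, where the weak type inequality applies.
      (M := ENNReal.ofReal (3 * κ) * ν univ) (by rwa [hωuniv]) fun t ht => by
        refine le_trans ?_ (hG.weak_type hκ ν ω t)
        gcongr ENNReal.ofReal t * ?_
        refine measure_mono_ae ?_
        filter_upwards [hac hpos, hac hlt, hac hsup] with x hx0 hx1 hx2 hx
        have hx' : ENNReal.ofReal t < kernelPotential G ν x / u x := hx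
        change ENNReal.ofReal t * kernelPotential G ω x < kernelPotential G ν x
        refine lt_of_le_of_lt ?_ (ENNReal.mul_lt_of_lt_div hx')
        gcongr
        exact (lintegral_mono' hωle le_rfl).trans hx2
    rw [one_div, ENNReal.rpow_inv_le_iff hq0]
    refine (h1.trans_le h2).trans (le_of_eq ?_)
    rw [hωuniv, ENNReal.mul_rpow_of_nonneg _ _ hq0.le, ENNReal.mul_rpow_of_nonneg _ _ hq0.le,
      ENNReal.mul_rpow_of_nonneg _ _ hq0.le, ENNReal.mul_rpow_of_nonneg _ _ hq0.le,
      ← ENNReal.rpow_mul, ← ENNReal.rpow_mul, inv_mul_cancel₀ hq0.ne',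
      div_mul_cancel₀ _ hq0.ne', ENNReal.rpow_one]
    ring
  have hr : 0 ≤ q / (1 - q) := by positivity
  refine (ENNReal.rpow_le_rpow hmain hr).trans (le_of_eq ?_)
  rw [ENNReal.mul_rpow_of_nonneg _ _ hr, ← ENNReal.rpow_mul,
    show (1 - q) / q * (q / (1 - q)) = 1 by field_simp, ENNReal.rpow_one]

/-- The lower bound of `𝐆(u^q dσ)` by the intrinsic potential. -/
lemma intrinsicPotential_le (hG : IsQuasiMetricKernel G κ) (hκ : 1 ≤ κ) (hq0 : 0 < q)
    (hq1 : q < 1) [SFinite σ] {u : Ω → ℝ≥0∞} (hum : Measurable u) (hpos : ∀ᵐ x ∂σ, 0 < u x)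
    (hlt : ∀ᵐ x ∂σ, u x < ∞)
    (hsup : ∀ᵐ x ∂σ, kernelPotential G (σ.withDensity fun y => u y ^ q) x ≤ u x)
    (x : Ω) :
    intrinsicPotential G q σ x
      ≤ (ENNReal.ofReal (1 / (1 - q)) ^ (1 / q) * ENNReal.ofReal (3 * κ)) ^ (q / (1 - q))
        * kernelPotential G (σ.withDensity fun y => u y ^ q) x := by
  have hq1' : 0 < 1 - q := by linarith
  have htop : (ENNReal.ofReal (1 / (1 - q)) ^ (1 / q) * ENNReal.ofReal (3 * κ)) ^ (q / (1 - q))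
      ≠ ∞ := by
    refine ENNReal.rpow_ne_top_of_nonneg (by positivity) (ENNReal.mul_ne_top ?_ ENNReal.ofReal_ne_top)
    exact ENNReal.rpow_ne_top_of_nonneg (by positivity) (by simp)
  rw [hG.kernelPotential_eq_tailIntegral, ← tailIntegral_const_mul _ htop]
  refine tailIntegral_mono fun r _ => ?_
  rw [withDensity_apply _ (hG.measurableSet_kernelBall x r)]
  exact hG.kappaConst_rpow_le hκ hq0 hq1 hum hpos hlt hsup (hG.measurableSet_kernelBall x r)

/-- The lower bound of `𝐆(u^q dσ)` by a power of `𝐆σ`. -/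
lemma kernelPotential_rpow_le (hG : IsQuasiMetricKernel G κ) (hκ : 1 ≤ κ) (hq0 : 0 < q)
    (hq1 : q < 1) {u : Ω → ℝ≥0∞} (hum : Measurable u) (hpos : ∀ᵐ x ∂σ, 0 < u x)
    (hsup : ∀ᵐ x ∂σ, kernelPotential G (σ.withDensity fun y => u y ^ q) x ≤ u x) (x : Ω) :
    kernelPotential G σ x ^ (1 / (1 - q))
      ≤ (ENNReal.ofReal (2 * κ) ^ q * ENNReal.ofReal (1 / (1 - q))) ^ (1 / (1 - q))
        * kernelPotential G (σ.withDensity fun y => u y ^ q) x := by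
  have hq1' : 0 < 1 - q := by linarith
  have hκ' : (1 : ℝ) ≤ κ := by exact_mod_cast hκ
  have hp : 0 < 1 / (1 - q) := by positivity
  have huq : Measurable fun y => u y ^ q := hum.pow_const q
  have hGx := hG.measurable_right x
  set ω := σ.withDensity fun y => u y ^ q with hω
  set ρ := ω.withDensity (G x) with hρ
  set A := ENNReal.ofReal (1 / (1 - q)) with hA
  set B := ENNReal.ofReal (2 * κ) with hB
  have hB0 : B ≠ 0 := by
    simp only [hB, ne_eq, ENNReal.ofReal_eq_zero, not_le]; positivity
  have hρuniv : ρ univ = kernelPotential G ω x := by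
    rw [hρ, withDensity_apply _ MeasurableSet.univ]; simp [kernelPotential]
  rw [← hρuniv]
  rcases eq_or_ne (ρ univ) ∞ with htop | htop
  · rw [htop, ENNReal.mul_top]
    · exact le_top
    · have : B ^ q * A ≠ 0 := mul_ne_zero (ENNReal.rpow_pos (pos_iff_ne_zero.2 hB0) ENNReal.ofReal_ne_top).ne' (by simp [hA, hq1])
      rw [ne_eq, ENNReal.rpow_eq_zero_iff]
      rintro (⟨h, -⟩ | ⟨-, h⟩)
      · exact this h
      · linarith
  -- `Λ` serves as a minorant of `u`, up to the factor `2κ`, whose negative power is integrable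
  -- against `ρ` with a bound depending only on `q` and `ρ univ`.
  set Λ : Ω → ℝ≥0∞ := fun y => ρ {z | G x z ≤ G x y} with hΛ
  have hΛm : Measurable Λ := by
    have : Monotone fun s : ℝ≥0∞ => ρ {z | G x z ≤ s} := fun s t hst =>
      measure_mono fun z hz => le_trans hz hst
    exact this.measurable.comp hGx
  have hfm : Measurable fun y => (Λ y)⁻¹ := hΛm.inv
  have hΛu : ∀ᵐ y ∂σ, Λ y ≤ B * u y := by
    filter_upwards [hsup] with y hy
    have hS : MeasurableSet {z | G x z ≤ G x y} := measurableSet_le hGx measurable_const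
    calc Λ y = ∫⁻ z in {z | G x z ≤ G x y}, G x z ∂ω := by
          rw [hΛ, hρ]; exact withDensity_apply _ hS
      _ ≤ ∫⁻ z in {z | G x z ≤ G x y}, B * G y z ∂ω :=
          setLIntegral_mono' hS fun z hz => hG.le_mul_of_le hκ hz
      _ ≤ ∫⁻ z, B * G y z ∂ω := setLIntegral_le_lintegral _ _
      _ = B * kernelPotential G ω y := lintegral_const_mul' _ _ ENNReal.ofReal_ne_top
      _ ≤ B * u y := by gcongr
  have hweak := lintegral_rpow_le_of_weak_type ρ hq0 hq1 (f := fun y => (Λ y)⁻¹) hfm (M := 1)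
    htop fun t ht => by
      have ht' : ENNReal.ofReal t ≠ 0 := by simpa using ht
      calc ENNReal.ofReal t * ρ {y | ENNReal.ofReal t < (Λ y)⁻¹}
          = ENNReal.ofReal t * ρ {y | Λ y < (ENNReal.ofReal t)⁻¹} := by
            congr 2; ext y; exact ENNReal.lt_inv_iff_lt_inv
        _ ≤ ENNReal.ofReal t * (ENNReal.ofReal t)⁻¹ := by
            gcongr; exact measure_setOf_measure_le_lt_le ρ (G x) _
        _ = 1 := ENNReal.mul_inv_cancel ht' ENNReal.ofReal_ne_top
  have hmain : kernelPotential G σ x ≤ B ^ q * A * ρ univ ^ (1 - q) := by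
    calc kernelPotential G σ x
        ≤ ∫⁻ y, B ^ q * (u y ^ q * (G x y * (Λ y)⁻¹ ^ q)) ∂σ := by
          refine lintegral_mono_ae ?_
          filter_upwards [hΛu, hpos] with y hy hy0
          -- Inserting this factor trades `σ` for `ω`. Where `Λ y = 0` the product is `∞` because `u
          -- y > 0`.
          have hone : 1 ≤ B ^ q * u y ^ q * (Λ y)⁻¹ ^ q := by
            rcases eq_or_ne (Λ y) 0 with h0 | h0
            · rw [h0, ENNReal.inv_zero, ENNReal.top_rpow_of_pos hq0, ENNReal.mul_top]
              · exact le_top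
              · refine mul_ne_zero (ENNReal.rpow_pos (pos_iff_ne_zero.2 hB0) ENNReal.ofReal_ne_top).ne' ?_
                simp [ENNReal.rpow_eq_zero_iff, hy0.ne', hq0.le]
            · have hΛtop : Λ y ≠ ∞ := ne_top_of_le_ne_top htop (measure_mono (subset_univ _))
              rw [← ENNReal.mul_rpow_of_nonneg _ _ hq0.le,
                ← ENNReal.mul_rpow_of_nonneg _ _ hq0.le]
              refine ENNReal.one_le_rpow ?_ hq0
              rw [← ENNReal.mul_inv_cancel h0 hΛtop]
              gcongr
          calc G x y = G x y * 1 := (mul_one _).symm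
            _ ≤ G x y * (B ^ q * u y ^ q * (Λ y)⁻¹ ^ q) := by gcongr
            _ = _ := by ring
      _ = B ^ q * ∫⁻ y, (Λ y)⁻¹ ^ q ∂ρ := by
          rw [lintegral_const_mul' _ _ (ENNReal.rpow_ne_top_of_nonneg hq0.le ENNReal.ofReal_ne_top), hρ,
            lintegral_withDensity_eq_lintegral_mul _ hGx (hfm.pow_const q), hω,
            lintegral_withDensity_eq_lintegral_mul _ huq
              (hGx.mul (hfm.pow_const q))]
          rfl
      _ ≤ B ^ q * (A * (1 ^ q * ρ univ ^ (1 - q))) := by gcongr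
      _ = _ := by rw [ENNReal.one_rpow]; ring
  refine (ENNReal.rpow_le_rpow hmain hp.le).trans (le_of_eq ?_)
  rw [ENNReal.mul_rpow_of_nonneg _ _ hp.le, ← ENNReal.rpow_mul,
    mul_one_div_cancel hq1'.ne', ENNReal.rpow_one]

end IsQuasiMetricKernel

/-! ### Absorption and the upper bound for subsolutions -/

/-- A weighted Young inequality. -/
lemma ENNReal.mul_rpow_le_add {q : ℝ} (hq0 : 0 < q) (hq1 : q < 1) (s b : ℝ≥0∞) {δ : ℝ≥0∞}
    (hδ0 : δ ≠ 0) (hδ : δ ≠ ∞) :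
    s * b ^ q ≤ δ * b + δ⁻¹ ^ (q / (1 - q)) * s ^ (1 / (1 - q)) := by
  have hq1' : 0 < 1 - q := by linarith
  have hr : 0 ≤ q / (1 - q) := by positivity
  -- Either `δ b` alone dominates, or `b ^ (1 - q) ≤ s / δ` and the second term does.
  rcases le_total s (δ * b ^ (1 - q)) with h | h
  · refine le_add_right ?_
    calc s * b ^ q ≤ δ * b ^ (1 - q) * b ^ q := by gcongr
      _ = δ * b := by
        rw [mul_assoc, ← ENNReal.rpow_add_of_nonneg _ _ hq1'.le hq0.le]; simp
  · refine le_add_left ?_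
    have hb : b ^ (1 - q) ≤ δ⁻¹ * s := (ENNReal.mul_le_iff_le_inv hδ0 hδ).1 h
    have hb' : b ^ q ≤ (δ⁻¹ * s) ^ (q / (1 - q)) := by
      calc b ^ q = (b ^ (1 - q)) ^ (q / (1 - q)) := by
            rw [← ENNReal.rpow_mul]; congr 1; field_simp
        _ ≤ _ := ENNReal.rpow_le_rpow hb hr
    calc s * b ^ q ≤ s * (δ⁻¹ * s) ^ (q / (1 - q)) := by gcongr
      _ = δ⁻¹ ^ (q / (1 - q)) * (s ^ (1 : ℝ) * s ^ (q / (1 - q))) := by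
        rw [ENNReal.mul_rpow_of_nonneg _ _ hr, ENNReal.rpow_one]; ring
      _ = _ := by
        rw [← ENNReal.rpow_add_of_nonneg _ _ zero_le_one hr]
        congr 2; field_simp; ring

lemma ENNReal.le_two_mul_of_le_half_add {t x : ℝ≥0∞} (ht : t ≠ ∞) (h : t ≤ 2⁻¹ * t + x) :
    t ≤ 2 * x := by
  have h2 : 2⁻¹ * t + 2⁻¹ * t ≤ 2⁻¹ * t + x := by
    rwa [← add_mul, ENNReal.inv_two_add_inv_two, one_mul]
  have h3 : 2⁻¹ * t ≤ x :=
    (ENNReal.add_le_add_iff_left (ENNReal.mul_ne_top (by simp) ht)).1 h2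
  calc t = 2 * (2⁻¹ * t) := by
        rw [← mul_assoc, ENNReal.mul_inv_cancel two_ne_zero ENNReal.ofNat_ne_top, one_mul]
    _ ≤ 2 * x := by gcongr

lemma tailIntegral_const (c : ℝ≥0∞) {a : ℝ} (ha : 0 ≤ a) :
    tailIntegral (fun _ => c) a = c * (ENNReal.ofReal a)⁻¹ := by
  rw [← tailIntegral_one ha]
  unfold tailIntegral
  rw [← lintegral_const_mul _ (by fun_prop)]
  simp only [mul_one_div]

lemma sublinearRHS_eq {Ω : Type*} [MeasurableSpace Ω] {G : Ω → Ω → ℝ≥0∞} {q : ℝ} {σ μ : Measure Ω}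
    (u : Ω → ℝ≥0∞) (x : Ω) :
    sublinearRHS G q σ μ u x = kernelPotential G (σ.withDensity (fun y => u y ^ q) + μ) x := by
  simp [sublinearRHS, kernelPotential, lintegral_add_measure]

lemma sublinearRHS_mono {Ω : Type*} [MeasurableSpace Ω] {G : Ω → Ω → ℝ≥0∞} {q : ℝ} {σ μ : Measure Ω}
    (hq0 : 0 < q) {u v : Ω → ℝ≥0∞} (h : u ≤ᵐ[σ] v) (x : Ω) :
    sublinearRHS G q σ μ u x ≤ sublinearRHS G q σ μ v x := by
  refine add_le_add ?_ le_rfl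
  refine lintegral_mono' (withDensity_mono ?_) le_rfl
  filter_upwards [h] with y hy using ENNReal.rpow_le_rpow hy hq0.le

namespace IsQuasiMetricKernel

variable {Ω : Type*} [TopologicalSpace Ω] {G : Ω → Ω → ℝ≥0∞} {κ : ℝ≥0}

/-- Finiteness of the tails does not depend on the center and on the lower limit. -/
lemma tailIntegral_lt_top (hG : IsQuasiMetricKernel G κ) (hκ : 1 ≤ κ) {m : Set Ω → ℝ≥0∞}
    (hm : Monotone m) {x₀ : Ω} {a₀ : ℝ} (ha₀ : 0 ≤ a₀)
    (h : tailIntegral (fun r => m (kernelBall G x₀ r)) a₀ < ∞) (x : Ω) {a : ℝ} (ha : 0 < a) :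
    tailIntegral (fun r => m (kernelBall G x r)) a < ∞ := by
  have hκ' : (1 : ℝ) ≤ κ := by exact_mod_cast hκ
  have hd := kernelDist_nonneg (G := G) x₀ x
  set d := kernelDist G x₀ x
  -- This dilation factor `c` has to satisfy `κ (d + r) ≤ c r` for `r > a` and `a₀ ≤ c a`; each
  -- summand takes care of one requirement.
  have hc : 0 < κ * (1 + d / a) + a₀ / a := by positivity
  refine lt_of_le_of_lt (tailIntegral_le_of_le_scale (b := a₀) hc ha.le ?_ fun r hr =>
    hm (hG.kernelBall_subset hκ x x₀ (ha.trans hr) ?_)) (ENNReal.mul_lt_top (by simp) h)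
  · rw [add_mul, div_mul_cancel₀ _ ha.ne']
    have : 0 ≤ κ * (1 + d / a) * a := by positivity
    linarith
  · have h1 : d ≤ d / a * r := by
      rw [div_mul_eq_mul_div, le_div_iff₀ ha]
      exact mul_le_mul_of_nonneg_left hr.le hd
    have h2 : 0 ≤ a₀ / a * r := mul_nonneg (by positivity) (ha.trans hr).le
    nlinarith

/-- Balls grow with the radius and `∫_r^∞ s⁻² ds = 1 / r`. Thus finite tails force finite mass on
balls. -/
lemma measure_kernelBall_le [MeasurableSpace Ω] (hG : IsQuasiMetricKernel G κ) (ω : Measure Ω) (x : Ω) {r : ℝ}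
    (hr : 0 < r) :
    ω (kernelBall G x r)
      ≤ ENNReal.ofReal r * tailIntegral (fun s => ω (kernelBall G x s)) r := by
  have h : tailIntegral (fun _ => ω (kernelBall G x r)) r
      ≤ tailIntegral (fun s => ω (kernelBall G x s)) r :=
    tailIntegral_mono fun s hs => hG.measure_kernelBall_mono ω x hr (hr.trans hs) hs.le
  rw [tailIntegral_const _ hr.le] at h
  calc ω (kernelBall G x r)
      = ENNReal.ofReal r * (ω (kernelBall G x r) * (ENNReal.ofReal r)⁻¹) := by
        rw [mul_left_comm, ENNReal.mul_inv_cancel (by simpa using hr) ENNReal.ofReal_ne_top,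
          mul_one]
    _ ≤ _ := by gcongr

variable [SecondCountableTopology Ω] [MeasurableSpace Ω] [BorelSpace Ω] {q : ℝ}

/-- Split `ω` at `B(x, 2κr)`: the near part is handled by the definition of `ϰ`, and the potential
of the far part is at most `2κ` times the tail of `ω`, uniformly on `B(x, r)`. Subadditivity of `t ↦
t^q` separates the two. -/
lemma setLIntegral_kernelPotential_rpow_le (hG : IsQuasiMetricKernel G κ) (hκ : 1 ≤ κ)
    (hq0 : 0 < q) (hq1 : q < 1) (σ ω : Measure Ω) [SFinite ω] (x : Ω) {r : ℝ} (hr : 0 < r)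
    (hfin : ω (kernelBall G x (2 * κ * r)) ≠ ∞) :
    ∫⁻ y in kernelBall G x r, kernelPotential G ω y ^ q ∂σ
      ≤ kappaConst G q σ (kernelBall G x r) ^ q * ω (kernelBall G x (2 * κ * r)) ^ q
        + (ENNReal.ofReal (2 * κ) * tailIntegral (fun s => ω (kernelBall G x s)) r) ^ q
          * σ (kernelBall G x r) := by
  set B' := kernelBall G x (2 * κ * r)
  have hB' : MeasurableSet B' := hG.measurableSet_kernelBall _ _
  set T := tailIntegral (fun s => ω (kernelBall G x s)) r with hT
  have hsplit : ∀ y ∈ kernelBall G x r, kernelPotential G ω y ^ q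
      ≤ kernelPotential G (ω.restrict B') y ^ q + (ENNReal.ofReal (2 * κ) * T) ^ q := by
    intro y hy
    refine le_trans (ENNReal.rpow_le_rpow ?_ hq0.le)
      (ENNReal.rpow_add_le_add_rpow _ _ hq0.le hq1.le)
    unfold kernelPotential
    rw [← lintegral_add_compl _ hB']
    gcongr
    rw [hT, hG.tailIntegral_measure_kernelBall ω x hr.le,
      ← lintegral_const_mul' _ _ ENNReal.ofReal_ne_top]
    refine (setLIntegral_mono' hB'.compl fun z hz => ?_).trans (setLIntegral_le_lintegral _ _)
    exact hG.le_of_notMem_kernelBall hκ hr hy hz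
  calc _ ≤ ∫⁻ y in kernelBall G x r, (kernelPotential G (ω.restrict B') y ^ q
        + (ENNReal.ofReal (2 * κ) * T) ^ q) ∂σ :=
        setLIntegral_mono' (hG.measurableSet_kernelBall x r) hsplit
    _ = (∫⁻ y in kernelBall G x r, kernelPotential G (ω.restrict B') y ^ q ∂σ)
        + (ENNReal.ofReal (2 * κ) * T) ^ q * σ (kernelBall G x r) := by
        rw [lintegral_add_right _ measurable_const, setLIntegral_const]
    _ ≤ _ := by
        gcongr
        refine (lintegral_kernelPotential_rpow_le hq0 _ _ ?_).trans (le_of_eq ?_)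
        · rwa [Measure.restrict_apply_univ]
        · rw [Measure.restrict_apply_univ]

/-- The tails of `(𝐆ω)^q dσ` are controlled by a fraction of the tails of `ω` and the tails of
`σ` and `ϰ`. -/
lemma tailIntegral_kernelPotential_rpow_le (hG : IsQuasiMetricKernel G κ) (hκ : 1 ≤ κ)
    (hq0 : 0 < q) (hq1 : q < 1) (σ ω : Measure Ω) [SFinite ω] (x : Ω) {ε : ℝ} (hε : 0 < ε)
    (hfin : ∀ r, 0 < r → tailIntegral (fun s => ω (kernelBall G x s)) r ≠ ∞) :
    tailIntegral (fun r => ∫⁻ y in kernelBall G x r, kernelPotential G ω y ^ q ∂σ) ε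
      ≤ 2⁻¹ * tailIntegral (fun r => ω (kernelBall G x r)) ε
        + ENNReal.ofReal (8 * κ) ^ (q / (1 - q))
          * (tailIntegral (fun r => σ (kernelBall G x r)) ε ^ (1 / (1 - q))
            + tailIntegral
              (fun r => kappaConst G q σ (kernelBall G x r) ^ (q / (1 - q))) ε) := by
  have hκ' : (1 : ℝ) ≤ κ := by exact_mod_cast hκ
  have hq1' : 0 < 1 - q := by linarith
  have hr0 : 0 ≤ q / (1 - q) := by positivity
  set B := ENNReal.ofReal (2 * κ) with hB
  set T := tailIntegral (fun r => ω (kernelBall G x r)) ε with hT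
  -- Young's inequality is used twice, for the near part and for the far part, and each use leaves
  -- `2κδ T`. The choice `δ = 1 / (8κ)` makes the sum `T / 2`.
  set δ := (ENNReal.ofReal (8 * κ))⁻¹ with hδ
  set D := ENNReal.ofReal (8 * κ) ^ (q / (1 - q)) with hD
  have hδ0 : δ ≠ 0 := by simp only [hδ, ne_eq, ENNReal.inv_eq_zero]; exact ENNReal.ofReal_ne_top
  have hδtop : δ ≠ ∞ := by
    simp only [hδ, ne_eq, ENNReal.inv_eq_top, ENNReal.ofReal_eq_zero, not_le]; positivity
  have hδD : δ⁻¹ ^ (q / (1 - q)) = D := by rw [hδ, inv_inv]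
  have hDtop : D ≠ ∞ := ENNReal.rpow_ne_top_of_nonneg hr0 ENNReal.ofReal_ne_top
  have hδB : δ * B + δ * B = 2⁻¹ := by
    have h8 : (0 : ℝ) < 8 * κ := by positivity
    rw [← mul_add, hδ, hB, ← ENNReal.ofReal_inv_of_pos h8,
      ← ENNReal.ofReal_add (by positivity) (by positivity),
      ← ENNReal.ofReal_mul (by positivity),
      show (8 * (κ : ℝ))⁻¹ * (2 * κ + 2 * κ) = 2⁻¹ by field_simp; norm_num,
      ENNReal.ofReal_inv_of_pos two_pos, ENNReal.ofReal_ofNat]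
  have hTtop : T ≠ ∞ := hfin ε hε
  have hBTtop : (B * T) ^ q ≠ ∞ :=
    ENNReal.rpow_ne_top_of_nonneg hq0.le (ENNReal.mul_ne_top ENNReal.ofReal_ne_top hTtop)
  have hpt : ∀ r, ε < r → ∫⁻ y in kernelBall G x r, kernelPotential G ω y ^ q ∂σ
      ≤ δ * ω (kernelBall G x (2 * κ * r))
        + (D * kappaConst G q σ (kernelBall G x r) ^ (q / (1 - q))
          + (B * T) ^ q * σ (kernelBall G x r)) := by
    intro r hr
    have hr0 : 0 < r := hε.trans hr
    have hωfin : ω (kernelBall G x (2 * κ * r)) ≠ ∞ :=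
      ne_top_of_le_ne_top (ENNReal.mul_ne_top ENNReal.ofReal_ne_top
        (hfin (2 * κ * r) (by positivity))) (hG.measure_kernelBall_le ω x (by positivity))
    refine (hG.setLIntegral_kernelPotential_rpow_le hκ hq0 hq1 σ ω x hr0 hωfin).trans ?_
    rw [← add_assoc]
    gcongr
    · refine (ENNReal.mul_rpow_le_add hq0 hq1 _ _ hδ0 hδtop).trans (le_of_eq ?_)
      rw [hδD, ← ENNReal.rpow_mul, mul_one_div]
    · exact tailIntegral_anti _ hr.le
  have hmω : MonotoneOn (fun r => δ * ω (kernelBall G x (2 * κ * r))) (Ioi 0) := by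
    intro r hr s hs hrs
    have hr' : 0 < r := hr
    have hs' : 0 < s := hs
    refine mul_le_mul_right (hG.measure_kernelBall_mono ω x
      (mem_Ioi.2 (by positivity)) (mem_Ioi.2 (by positivity)) ?_) _
    gcongr
  have hmκ : MonotoneOn
      (fun r => D * kappaConst G q σ (kernelBall G x r) ^ (q / (1 - q))) (Ioi 0) := by
    intro r hr s hs hrs
    refine mul_le_mul_right (ENNReal.rpow_le_rpow ?_ hr0) _
    exact kappaConst_mono hq0 (hG.kernelBall_mono x hr hs hrs)
  refine (tailIntegral_mono hpt).trans ?_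
  rw [tailIntegral_add hmω _ hε.le, tailIntegral_add hmκ _ hε.le,
    tailIntegral_const_mul _ hδtop, tailIntegral_const_mul _ hDtop,
    tailIntegral_const_mul _ hBTtop,
    tailIntegral_scale (fun r => ω (kernelBall G x r)) (by positivity) hε.le]
  set S := tailIntegral (fun r => σ (kernelBall G x r)) ε
  set R := tailIntegral (fun r => kappaConst G q σ (kernelBall G x r) ^ (q / (1 - q))) ε
  have h1 : tailIntegral (fun r => ω (kernelBall G x r)) (2 * κ * ε) ≤ T :=
    tailIntegral_anti _ (by nlinarith)
  have h2 : (B * T) ^ q * S ≤ δ * (B * T) + D * S ^ (1 / (1 - q)) := by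
    rw [mul_comm, ← hδD]
    exact ENNReal.mul_rpow_le_add hq0 hq1 _ _ hδ0 hδtop
  calc _ ≤ δ * (B * T) + (D * R + (δ * (B * T) + D * S ^ (1 / (1 - q)))) := by gcongr
    _ = (δ * B + δ * B) * T + D * (S ^ (1 / (1 - q)) + R) := by ring
    _ = _ := by rw [hδB]

variable {σ μ : Measure Ω}

/-- The measure `ω` is kept separate from the one built from `v` so that the bound serves both a
subsolution, where they coincide, and consecutive iterates. -/
lemma tailIntegral_withDensity_add_le (hG : IsQuasiMetricKernel G κ) (hκ : 1 ≤ κ)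
    (hq0 : 0 < q) (hq1 : q < 1) (ω : Measure Ω) [SFinite ω] {v : Ω → ℝ≥0∞}
    (hv : ∀ᵐ y ∂σ, v y ≤ kernelPotential G ω y) (x : Ω) {ε : ℝ} (hε : 0 < ε)
    (hfin : ∀ r, 0 < r → tailIntegral (fun s => ω (kernelBall G x s)) r ≠ ∞) :
    tailIntegral
        (fun r => (σ.withDensity (fun y => v y ^ q) + μ) (kernelBall G x r)) ε
      ≤ 2⁻¹ * tailIntegral (fun r => ω (kernelBall G x r)) ε
        + (ENNReal.ofReal (8 * κ) ^ (q / (1 - q))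
          * (tailIntegral (fun r => σ (kernelBall G x r)) ε ^ (1 / (1 - q))
            + tailIntegral
              (fun r => kappaConst G q σ (kernelBall G x r) ^ (q / (1 - q))) ε)
          + tailIntegral (fun r => μ (kernelBall G x r)) ε) := by
  rw [← add_assoc]
  simp only [Measure.coe_add, Pi.add_apply]
  rw [tailIntegral_add (hG.measure_kernelBall_mono _ x) _ hε.le]
  gcongr
  refine le_trans (tailIntegral_mono fun r _ => ?_)
    (hG.tailIntegral_kernelPotential_rpow_le hκ hq0 hq1 σ ω x hε hfin)
  rw [withDensity_apply _ (hG.measurableSet_kernelBall x r)]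
  refine lintegral_mono_ae (ae_restrict_of_ae ?_)
  filter_upwards [hv] with y hy using ENNReal.rpow_le_rpow hy hq0.le

/-- The upper bound for subsolutions. -/
lemma sublinearRHS_le [SFinite σ] [SFinite μ] (hG : IsQuasiMetricKernel G κ) (hκ : 1 ≤ κ)
    (hq0 : 0 < q) (hq1 : q < 1) {u : Ω → ℝ≥0∞}
    (hu : ∀ᵐ y ∂σ, u y ≤ sublinearRHS G q σ μ u y) {x₀ : Ω}
    (hx₀ : sublinearRHS G q σ μ u x₀ < ∞) (x : Ω) :
    sublinearRHS G q σ μ u x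
      ≤ 2 * ENNReal.ofReal (8 * κ) ^ (q / (1 - q)) * (kernelPotential G σ x ^ (1 / (1 - q))
        + intrinsicPotential G q σ x + kernelPotential G μ x) := by
  have hκ' : (1 : ℝ) ≤ κ := by exact_mod_cast hκ
  have hq1' : 0 < 1 - q := by linarith
  have hr0 : 0 < q / (1 - q) := by positivity
  simp only [sublinearRHS_eq] at hu hx₀ ⊢
  set ω := σ.withDensity (fun y => u y ^ q) + μ with hω
  set D := ENNReal.ofReal (8 * κ) ^ (q / (1 - q)) with hD
  have hD1 : 1 ≤ D := by
    refine ENNReal.one_le_rpow ?_ hr0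
    rw [ENNReal.one_le_ofReal]; linarith
  rw [hG.kernelPotential_eq_tailIntegral] at hx₀
  -- Finiteness at the single point `x₀` gives finite tails at every `x`, even where the potential
  -- is infinite. This is what permits the absorption.
  have hfin : ∀ r, 0 < r → tailIntegral (fun s => ω (kernelBall G x s)) r ≠ ∞ := fun r hr =>
    (hG.tailIntegral_lt_top hκ (m := ω) (fun _ _ h => measure_mono h) le_rfl hx₀ x hr).ne
  rw [hG.kernelPotential_eq_tailIntegral]
  refine tailIntegral_zero_le fun ε hε => ?_
  have h1 := ENNReal.le_two_mul_of_le_half_add (hfin ε hε)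
    (hG.tailIntegral_withDensity_add_le hκ hq0 hq1 ω hu x hε hfin)
  refine h1.trans ?_
  rw [hG.kernelPotential_eq_tailIntegral σ, hG.kernelPotential_eq_tailIntegral μ,
    show intrinsicPotential G q σ x = tailIntegral
      (fun r => kappaConst G q σ (kernelBall G x r) ^ (q / (1 - q))) 0 from rfl, mul_assoc]
  gcongr 2 * ?_
  rw [mul_add D (_ + _)]
  refine add_le_add ?_ ?_
  · gcongr D * (?_ ^ _ + ?_)
    · exact tailIntegral_anti _ hε.le
    · exact tailIntegral_anti _ hε.le
  · exact (tailIntegral_anti _ hε.le).trans (le_mul_of_one_le_left zero_le hD1)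

lemma measurable_sublinearRHS [SFinite σ] [SFinite μ] (hG : IsQuasiMetricKernel G κ)
    (u : Ω → ℝ≥0∞) :
    Measurable (sublinearRHS G q σ μ u) :=
  (hG.measurable_kernelPotential _).add (hG.measurable_kernelPotential _)

lemma kernelPotential_pos (hG : IsQuasiMetricKernel G κ) {ν : Measure Ω} (hν : ν ≠ 0) (x : Ω) :
    0 < kernelPotential G ν x := by
  unfold kernelPotential
  rw [lintegral_pos_iff_support (hG.measurable_right x)]
  have : Function.support (fun y => G x y) = univ := by
    ext y; simp [(hG.pos x y).ne']
  rw [this]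
  exact pos_iff_ne_zero.2 fun h => hν (Measure.measure_univ_eq_zero.1 h)

end IsQuasiMetricKernel

/-! ### Self-improving comparison -/

/-- Two solutions that are comparable up to a constant are ordered. -/
lemma ae_le_of_ae_le_const_mul {Ω : Type*} [MeasurableSpace Ω] {G : Ω → Ω → ℝ≥0∞} {q : ℝ}
    {σ μ : Measure Ω} (hq0 : 0 < q) (hq1 : q < 1) {u v : Ω → ℝ≥0∞}
    (hu : ∀ᵐ x ∂σ, u x ≤ sublinearRHS G q σ μ u x)
    (hv : ∀ᵐ x ∂σ, sublinearRHS G q σ μ v x ≤ v x) {K : ℝ≥0} (hK : 1 ≤ K)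
    (h : ∀ᵐ x ∂σ, u x ≤ K * v x) : ∀ᵐ x ∂σ, u x ≤ v x := by
  -- Passing a bound `u ≤ L v` through the equation replaces `L` by `L^q`; as `L^q ≥ 1`, the term
  -- `𝐆μ` does no harm.
  have step : ∀ n : ℕ, ∀ᵐ x ∂σ, u x ≤ ((K ^ (q ^ n) : ℝ≥0) : ℝ≥0∞) * v x := by
    intro n
    induction n with
    | zero => simpa using h
    | succ n ih =>
      set L : ℝ≥0 := K ^ (q ^ n) with hL
      have hL1 : 1 ≤ L := NNReal.one_le_rpow hK (by positivity)
      have hLq : (K ^ (q ^ (n + 1)) : ℝ≥0) = L ^ q := by rw [hL, ← NNReal.rpow_mul, pow_succ]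
      have hLq1 : (1 : ℝ≥0∞) ≤ (L ^ q : ℝ≥0) := by
        exact_mod_cast NNReal.one_le_rpow hL1 hq0.le
      filter_upwards [hu, hv] with x hux hvx
      rw [hLq]
      calc u x ≤ sublinearRHS G q σ μ u x := hux
        _ ≤ sublinearRHS G q σ μ (fun y => L * v y) x := sublinearRHS_mono hq0 ih x
        _ = (L ^ q : ℝ≥0) * kernelPotential G (σ.withDensity fun y => v y ^ q) x
            + kernelPotential G μ x := by
          unfold sublinearRHS
          have : (fun y => ((L : ℝ≥0∞) * v y) ^ q)
              = ((L ^ q : ℝ≥0) : ℝ≥0∞) • fun y => v y ^ q := by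
            ext y
            rw [ENNReal.mul_rpow_of_nonneg _ _ hq0.le, ENNReal.coe_rpow_of_nonneg _ hq0.le]
            rfl
          rw [this, withDensity_smul' _ _ ENNReal.coe_ne_top]
          unfold kernelPotential
          rw [lintegral_smul_measure, smul_eq_mul]
        _ ≤ (L ^ q : ℝ≥0) * sublinearRHS G q σ μ v x := by
          unfold sublinearRHS
          rw [mul_add]
          gcongr
          exact le_mul_of_one_le_left zero_le hLq1
        _ ≤ _ := by gcongr
  have hlim : Filter.Tendsto (fun n : ℕ => ((K ^ (q ^ n) : ℝ≥0) : ℝ≥0∞)) Filter.atTop (nhds 1) := by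
    rw [← ENNReal.coe_one, ENNReal.tendsto_coe]
    have h0 := tendsto_pow_atTop_nhds_zero_of_lt_one hq0.le hq1
    have hK0 : K ≠ 0 := (one_pos.trans_le hK).ne'
    have h1 : Filter.Tendsto (fun n : ℕ => ((K : ℝ) ^ (q ^ n))) Filter.atTop (nhds 1) := by
      have := (Real.continuous_const_rpow (a := (K : ℝ)) (by exact_mod_cast hK0)).tendsto 0
      rw [Real.rpow_zero] at this
      exact this.comp h0
    rw [← NNReal.tendsto_coe]
    simpa using h1
  filter_upwards [ae_all_iff.2 step] with x hx
  have := ENNReal.Tendsto.mul_const (b := v x) hlim (Or.inl one_ne_zero)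
  rw [one_mul] at this
  exact ge_of_tendsto' this hx

/-! ### Tail conditions and existence of solutions -/

lemma TailConditions.iff_tailIntegral {Ω : Type*} [TopologicalSpace Ω] [MeasurableSpace Ω]
    {G : Ω → Ω → ℝ≥0∞} {q : ℝ} {σ μ : Measure Ω} {x : Ω} {a : ℝ} :
    TailConditions G q σ μ x a ↔ tailIntegral (fun r => σ (kernelBall G x r)) a < ∞ ∧
      tailIntegral (fun r => kappaConst G q σ (kernelBall G x r) ^ (q / (1 - q))) a < ∞ ∧
      tailIntegral (fun r => μ (kernelBall G x r)) a < ∞ := Iff.rfl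

namespace IsQuasiMetricKernel

variable {Ω : Type*} [TopologicalSpace Ω] {G : Ω → Ω → ℝ≥0∞} {κ : ℝ≥0}

lemma iUnion_kernelBall (hG : IsQuasiMetricKernel G κ) (x : Ω) :
    ⋃ n : ℕ, kernelBall G x ((n : ℝ) + 1) = univ := by
  refine eq_univ_of_forall fun y => mem_iUnion.2 ?_
  obtain ⟨n, hn⟩ := exists_nat_gt (kernelDist G x y)
  exact ⟨n, (hG.mem_kernelBall (by positivity)).2 (hn.trans (by linarith))⟩

lemma tailConditions_of_tailConditions [MeasurableSpace Ω] {q : ℝ} {σ μ : Measure Ω}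
    (hG : IsQuasiMetricKernel G κ) (hκ : 1 ≤ κ) (hq0 : 0 < q) (hq1 : q < 1) {x₀ : Ω} {a₀ : ℝ}
    (ha₀ : 0 ≤ a₀) (h : TailConditions G q σ μ x₀ a₀) (x : Ω) {a : ℝ} (ha : 0 < a) :
    TailConditions G q σ μ x a := by
  have hq1' : 0 < 1 - q := by linarith
  rw [TailConditions.iff_tailIntegral] at h ⊢
  exact ⟨hG.tailIntegral_lt_top hκ (m := σ) (fun _ _ h => measure_mono h) ha₀ h.1 x ha,
    hG.tailIntegral_lt_top hκ (m := fun E => kappaConst G q σ E ^ (q / (1 - q)))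
      (fun _ _ h => ENNReal.rpow_le_rpow (kappaConst_mono hq0 h) (by positivity)) ha₀ h.2.1 x ha,
    hG.tailIntegral_lt_top hκ (m := μ) (fun _ _ h => measure_mono h) ha₀ h.2.2 x ha⟩

/-- A small multiple of the indicator of a ball of positive measure is a subsolution. -/
lemma exists_indicator_le_sublinearRHS [MeasurableSpace Ω] [BorelSpace Ω]
    {q : ℝ} {σ μ : Measure Ω} (hG : IsQuasiMetricKernel G κ) (hκ : 1 ≤ κ)
    (hq0 : 0 < q) (hq1 : q < 1) {x₀ : Ω} {r : ℝ} (hr : 0 < r)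
    (h0 : σ (kernelBall G x₀ r) ≠ 0) (htop : σ (kernelBall G x₀ r) ≠ ∞) :
    ∃ ε : ℝ≥0∞, ε ≠ 0 ∧ ε ≠ ∞ ∧ ∀ x, (kernelBall G x₀ r).indicator (fun _ => ε) x
      ≤ sublinearRHS G q σ μ ((kernelBall G x₀ r).indicator fun _ => ε) x := by
  have hκ' : (1 : ℝ) ≤ κ := by exact_mod_cast hκ
  have hq1' : 0 < 1 - q := by linarith
  set F := kernelBall G x₀ r
  have hF : MeasurableSet F := hG.measurableSet_kernelBall _ _
  have hb0 : ENNReal.ofReal (2 * κ * r) ≠ 0 := by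
    simp only [ne_eq, ENNReal.ofReal_eq_zero, not_le]; positivity
  -- On `F × F` the kernel is at least `1 / (2κr)`, so the right-hand side is at least `s ε^q` on
  -- `F`. Solving `s ε^q = ε` determines `ε`.
  set s := (ENNReal.ofReal (2 * κ * r))⁻¹ * σ F with hs
  have hs0 : s ≠ 0 := mul_ne_zero (ENNReal.inv_ne_zero.2 ENNReal.ofReal_ne_top) h0
  have hs_fin : s ≠ ∞ := ENNReal.mul_ne_top (by simpa using hb0) htop
  set ε := s ^ (1 / (1 - q)) with hε
  have hε0 : ε ≠ 0 := (ENNReal.rpow_pos (pos_iff_ne_zero.2 hs0) hs_fin).ne'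
  have hεtop : ε ≠ ∞ := ENNReal.rpow_ne_top_of_nonneg (by positivity) hs_fin
  refine ⟨ε, hε0, hεtop, fun x => ?_⟩
  by_cases hx : x ∈ F
  · rw [indicator_of_mem hx]
    have hdens : (fun y => (F.indicator (fun _ => ε) y : ℝ≥0∞) ^ q)
        = F.indicator fun _ => ε ^ q := by
      ext y
      by_cases hy : y ∈ F <;> simp [hy, hq0]
    have hpow : ε = s * ε ^ q := by
      have h1 : s = ε ^ (1 - q) := by
        rw [hε, ← ENNReal.rpow_mul, one_div_mul_cancel hq1'.ne', ENNReal.rpow_one]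
      calc ε = ε ^ (1 - q + q) := by simp
        _ = ε ^ (1 - q) * ε ^ q := ENNReal.rpow_add _ _ hε0 hεtop
        _ = s * ε ^ q := by rw [← h1]
    refine le_add_right ?_
    rw [hdens, withDensity_indicator hF, withDensity_const]
    unfold kernelPotential
    rw [lintegral_smul_measure, smul_eq_mul]
    calc ε = ε ^ q * s := by rw [mul_comm]; exact hpow
      _ ≤ ε ^ q * ∫⁻ y in F, G x y ∂σ := by
        gcongr
        rw [hs, ← setLIntegral_const]
        refine setLIntegral_mono' hF fun y hy => ?_
        rw [hG.eq_inv_kernelDist x y]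
        refine ENNReal.inv_le_inv.2 (ENNReal.ofReal_le_ofReal ?_)
        have h1 := (hG.mem_kernelBall hr).1 hx
        have h2 := (hG.mem_kernelBall hr).1 hy
        have h3 := hG.kernelDist_triangle x y x₀
        rw [hG.kernelDist_comm x x₀] at h3
        nlinarith
  · rw [indicator_of_notMem hx]
    exact zero_le

variable [SecondCountableTopology Ω] [MeasurableSpace Ω] [BorelSpace Ω] {q : ℝ}
  {σ μ : Measure Ω} [SFinite σ] [SFinite μ]

/-- The tail conditions imply the existence of a solution, by monotone iteration. -/
lemma exists_solution (hG : IsQuasiMetricKernel G κ) (hκ : 1 ≤ κ) (hq0 : 0 < q)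
    (hq1 : q < 1) (hσ : σ ≠ 0)
    (htail : ∀ (x₀ : Ω) (a : ℝ), 0 < a → TailConditions G q σ μ x₀ a) :
    ∃ u : Ω → ℝ≥0∞, IsNontrivialSolution G q σ μ u := by
  have hq1' : 0 < 1 - q := by linarith
  have hr0 : 0 < q / (1 - q) := by positivity
  have hne : Nonempty Ω := by
    by_contra hcon
    rw [not_nonempty_iff] at hcon
    exact hσ (Measure.eq_zero_of_isEmpty σ)
  obtain ⟨x₀⟩ := hne
  simp only [TailConditions.iff_tailIntegral] at htail
  obtain ⟨n, hn⟩ : ∃ n : ℕ, σ (kernelBall G x₀ ((n : ℝ) + 1)) ≠ 0 := by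
    by_contra! hcon
    apply hσ
    rw [← Measure.measure_univ_eq_zero, ← hG.iUnion_kernelBall x₀]
    exact measure_iUnion_null hcon
  have hρ : 0 < (n : ℝ) + 1 := by positivity
  set F := kernelBall G x₀ ((n : ℝ) + 1) with hFdef
  have hF : MeasurableSet F := hG.measurableSet_kernelBall _ _
  have hFtop : σ F ≠ ∞ := ne_top_of_le_ne_top
    (ENNReal.mul_ne_top ENNReal.ofReal_ne_top (htail x₀ _ hρ).1.ne)
    (hG.measure_kernelBall_le σ x₀ hρ)
  obtain ⟨ε, hε0, hεtop, hε⟩ := hG.exists_indicator_le_sublinearRHS (μ := μ) hκ hq0 hq1 hρ hn hFtop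
  -- Starting from a subsolution makes the sequence increase; starting from 0 would give only 0 when
  -- `μ = 0`.
  let u : ℕ → Ω → ℝ≥0∞ := fun n => (sublinearRHS G q σ μ)^[n] (F.indicator fun _ => ε)
  have husucc : ∀ n, u (n + 1) = sublinearRHS G q σ μ (u n) := fun n =>
    Function.iterate_succ_apply' _ _ _
  have humeas : ∀ n, Measurable (u n) := by
    intro n
    cases n with
    | zero => exact measurable_const.indicator hF
    | succ n => rw [husucc]; exact hG.measurable_sublinearRHS _
  have humono : Monotone u := by
    refine monotone_nat_of_le_succ fun n => ?_
    induction n with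
    | zero => exact hε
    | succ n ih =>
      rw [husucc n, husucc (n + 1)]
      exact fun x => sublinearRHS_mono hq0 (ae_of_all _ ih) x
  let ω : ℕ → Measure Ω := fun n => σ.withDensity (fun y => u n y ^ q) + μ
  have hueq : ∀ n x, u (n + 1) x = kernelPotential G (ω n) x := fun n x => by
    rw [husucc, sublinearRHS_eq]
  have hrec : ∀ n (x : Ω) (a : ℝ), 0 < a →
      (∀ r, 0 < r → tailIntegral (fun s => ω n (kernelBall G x s)) r ≠ ∞) →
      tailIntegral (fun r => ω (n + 1) (kernelBall G x r)) a
        ≤ 2⁻¹ * tailIntegral (fun r => ω n (kernelBall G x r)) a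
        + (ENNReal.ofReal (8 * κ) ^ (q / (1 - q))
          * (tailIntegral (fun r => σ (kernelBall G x r)) a ^ (1 / (1 - q))
            + tailIntegral
              (fun r => kappaConst G q σ (kernelBall G x r) ^ (q / (1 - q))) a)
          + tailIntegral (fun r => μ (kernelBall G x r)) a) := fun n x a ha h =>
    hG.tailIntegral_withDensity_add_le hκ hq0 hq1 (ω n)
      (ae_of_all _ fun y => (hueq n y).le) x ha h
  have hXtop : ∀ (x : Ω) (a : ℝ), 0 < a → (ENNReal.ofReal (8 * κ) ^ (q / (1 - q))
          * (tailIntegral (fun r => σ (kernelBall G x r)) a ^ (1 / (1 - q))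
            + tailIntegral
              (fun r => kappaConst G q σ (kernelBall G x r) ^ (q / (1 - q))) a)
          + tailIntegral (fun r => μ (kernelBall G x r)) a) ≠ ∞ := by
    intro x a ha
    obtain ⟨h1, h2, h3⟩ := htail x a ha
    refine ENNReal.add_ne_top.2 ⟨ENNReal.mul_ne_top
      (ENNReal.rpow_ne_top_of_nonneg hr0.le ENNReal.ofReal_ne_top)
      (ENNReal.add_ne_top.2 ⟨ENNReal.rpow_ne_top_of_nonneg (by positivity) h1.ne, h2.ne⟩), h3.ne⟩
  -- This bound may depend on `n`: it only licenses the absorption in `hbound`, where `ω n ≤ ω (n +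
  -- 1)` turns the recursion into an estimate uniform in `n`.
  have hfin : ∀ n (x : Ω) (a : ℝ), 0 < a →
      tailIntegral (fun s => ω n (kernelBall G x s)) a ≠ ∞ := by
    intro n
    induction n with
    | zero =>
      intro x a ha
      have hεq : ε ^ q ≠ ∞ := ENNReal.rpow_ne_top_of_nonneg hq0.le hεtop
      have hle : ∀ r, a < r → ω 0 (kernelBall G x r)
          ≤ μ (kernelBall G x r) + ε ^ q * σ (kernelBall G x r) := by
        intro r _
        simp only [ω, Measure.coe_add, Pi.add_apply]
        rw [add_comm, withDensity_apply _ (hG.measurableSet_kernelBall x r), ← setLIntegral_const]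
        gcongr with y
        exact indicator_le_self' (fun _ _ => zero_le) y
      refine ne_top_of_le_ne_top ?_ (tailIntegral_mono hle)
      rw [tailIntegral_add (hG.measure_kernelBall_mono μ x) _ ha.le, tailIntegral_const_mul _ hεq]
      exact ENNReal.add_ne_top.2 ⟨(htail x a ha).2.2.ne, ENNReal.mul_ne_top hεq (htail x a ha).1.ne⟩
    | succ n ih =>
      intro x a ha
      exact ne_top_of_le_ne_top (ENNReal.add_ne_top.2
        ⟨ENNReal.mul_ne_top (by simp) (ih x a ha), hXtop x a ha⟩) (hrec n x a ha (ih x))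
  have hωmono : ∀ n, ω n ≤ ω (n + 1) := fun n =>
    add_le_add (withDensity_mono (ae_of_all _ fun y =>
      ENNReal.rpow_le_rpow (humono (Nat.le_succ n) y) hq0.le)) le_rfl
  have hbound : ∀ (x : Ω) (a : ℝ), 0 < a → ∃ X : ℝ≥0∞, X ≠ ∞ ∧ ∀ n,
      ∫⁻ y in kernelBall G x a, u n y ^ q ∂σ ≤ X := by
    intro x a ha
    refine ⟨_, ENNReal.mul_ne_top (ENNReal.ofReal_ne_top (r := a))
      (ENNReal.mul_ne_top (ENNReal.ofNat_ne_top (n := 2)) (hXtop x a ha)), fun n => ?_⟩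
    have h1 := ENNReal.le_two_mul_of_le_half_add (hfin n x a ha)
      ((tailIntegral_mono fun r _ => hωmono n (kernelBall G x r)).trans
        (hrec n x a ha (hfin n x)))
    calc ∫⁻ y in kernelBall G x a, u n y ^ q ∂σ ≤ ω n (kernelBall G x a) := by
          simp only [ω, Measure.coe_add, Pi.add_apply]
          rw [withDensity_apply _ (hG.measurableSet_kernelBall x a)]
          exact le_self_add
      _ ≤ _ := (hG.measure_kernelBall_le (ω n) x ha).trans (by gcongr)
  let U : Ω → ℝ≥0∞ := fun x => ⨆ n, u n x
  have hUmeas : Measurable U := Measurable.iSup humeas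
  have hUq : ∀ y, U y ^ q = ⨆ n, u n y ^ q := fun y =>
    (ENNReal.orderIsoRpow q hq0).map_iSup _
  have hqmono : Monotone fun n y => u n y ^ q := fun m n hmn y =>
    ENNReal.rpow_le_rpow (humono hmn y) hq0.le
  have hpot : ∀ {w : Ω → ℝ≥0∞}, Measurable w → ∀ x,
      kernelPotential G (σ.withDensity fun y => w y ^ q) x = ∫⁻ y, w y ^ q * G x y ∂σ :=
    fun hw x => lintegral_withDensity_eq_lintegral_mul _ (hw.pow_const q) (hG.measurable_right x)
  have hUeq : ∀ x, U x = sublinearRHS G q σ μ U x := by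
    intro x
    have h1 : U x = ⨆ n, u (n + 1) x :=
      (Monotone.iSup_nat_add (f := fun n => u n x) (fun m n hmn => humono hmn x) 1).symm
    rw [h1]
    unfold sublinearRHS
    rw [hpot hUmeas]
    simp_rw [hUq, ENNReal.iSup_mul]
    rw [lintegral_iSup (f := fun n y => u n y ^ q * G x y)
      (fun n => ((humeas n).pow_const q).mul (hG.measurable_right x))
      (fun m n hmn y => mul_le_mul_left (hqmono hmn y) _), ENNReal.iSup_add]
    refine iSup_congr fun n => ?_
    rw [husucc, sublinearRHS, hpot (humeas n)]
  have hUtop : ∀ᵐ x ∂σ, U x < ∞ := by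
    have hball : ∀ k : ℕ, ∀ᵐ x ∂σ, x ∈ kernelBall G x₀ ((k : ℝ) + 1) → U x < ∞ := by
      intro k
      have hk : 0 < (k : ℝ) + 1 := by positivity
      rw [← ae_restrict_iff' (hG.measurableSet_kernelBall _ _)]
      obtain ⟨X, hX, hle⟩ := hbound x₀ _ hk
      have hint : ∫⁻ y in kernelBall G x₀ ((k : ℝ) + 1), U y ^ q ∂σ ≠ ∞ := by
        refine ne_top_of_le_ne_top hX ?_
        simp_rw [hUq]
        rw [lintegral_iSup (fun n => (humeas n).pow_const q) hqmono]
        exact iSup_le hle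
      filter_upwards [ae_lt_top (hUmeas.pow_const q) hint] with y hy
      by_contra hcon
      rw [not_lt, top_le_iff] at hcon
      rw [hcon, ENNReal.top_rpow_of_pos hq0] at hy
      exact lt_irrefl _ hy
    filter_upwards [ae_all_iff.2 hball] with x hx
    have hmem : x ∈ ⋃ k : ℕ, kernelBall G x₀ ((k : ℝ) + 1) := by
      rw [hG.iUnion_kernelBall]; trivial
    obtain ⟨k, hk⟩ := mem_iUnion.1 hmem
    exact hx k hk
  have hUpos : ∀ x, 0 < U x := by
    intro x
    refine lt_of_lt_of_le ?_ (le_iSup (fun n => u n x) 1)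
    rw [show u 1 x = _ from hueq 0 x]
    refine hG.kernelPotential_pos (fun h => ?_) x
    have h1 : ω 0 F = 0 := by rw [h]; simp
    simp only [ω, Measure.coe_add, Pi.add_apply, add_eq_zero] at h1
    have h2 := h1.1
    rw [withDensity_apply _ hF] at h2
    have h3 : ∫⁻ y in F, u 0 y ^ q ∂σ = ε ^ q * σ F := by
      rw [← setLIntegral_const]
      exact setLIntegral_congr_fun hF fun y hy => by simp [u, hy]
    rw [h3, mul_eq_zero] at h2
    exact h2.elim (ENNReal.rpow_pos (pos_iff_ne_zero.2 hε0) hεtop).ne' hn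
  refine ⟨U, ⟨hUmeas, ae_of_all _ fun x => (hUeq x).le, ?_⟩, hUmeas, ae_of_all _ hUpos,
    ae_of_all _ fun x => (hUeq x).ge, hUtop⟩
  filter_upwards [hUtop] with x hx
  rwa [← hUeq x]

end IsQuasiMetricKernel

/-! ### Pointwise estimates and assembly -/

namespace IsQuasiMetricKernel

variable {Ω : Type*} [TopologicalSpace Ω] {G : Ω → Ω → ℝ≥0∞} {κ : ℝ≥0}
  [SecondCountableTopology Ω] [MeasurableSpace Ω] [BorelSpace Ω] {q : ℝ}
  {σ μ : Measure Ω} [SFinite σ]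

/-- The lower bound for supersolutions. -/
lemma lowerEstimateAt (hG : IsQuasiMetricKernel G κ) (hκ : 1 ≤ κ) (hq0 : 0 < q) (hq1 : q < 1)
    {c : ℝ≥0} (hc : (c : ℝ≥0∞)
      * ((ENNReal.ofReal (2 * κ) ^ q * ENNReal.ofReal (1 / (1 - q))) ^ (1 / (1 - q))
        + (ENNReal.ofReal (1 / (1 - q)) ^ (1 / q) * ENNReal.ofReal (3 * κ)) ^ (q / (1 - q))) ≤ 1)
    {u : Ω → ℝ≥0∞} (hu : IsNontrivialSupersolution G q σ μ u) {x : Ω}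
    (hx : sublinearRHS G q σ μ u x ≤ u x) : LowerEstimateAt c G q σ μ u x := by
  have hsup : ∀ᵐ x ∂σ, kernelPotential G (σ.withDensity fun y => u y ^ q) x ≤ u x := by
    filter_upwards [hu.rhs_le] with y hy using le_trans le_self_add hy
  refine le_trans ?_ hx
  refine add_le_add ?_ le_rfl
  refine (mul_le_mul_right (add_le_add
    (hG.kernelPotential_rpow_le hκ hq0 hq1 hu.measurable hu.pos hsup x)
    (hG.intrinsicPotential_le hκ hq0 hq1 hu.measurable hu.pos hu.lt_top hsup x)) _).trans ?_
  rw [← add_mul, ← mul_assoc]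
  exact mul_le_of_le_one_left zero_le hc

lemma upperEstimateAt [SFinite μ] (hG : IsQuasiMetricKernel G κ) (hκ : 1 ≤ κ) (hq0 : 0 < q) (hq1 : q < 1)
    (hσ : σ ≠ 0) {C : ℝ≥0} (hC : 2 * ENNReal.ofReal (8 * κ) ^ (q / (1 - q)) ≤ (C : ℝ≥0∞))
    {u : Ω → ℝ≥0∞} (hu : IsSubsolution G q σ μ u) {x : Ω}
    (hx : u x ≤ sublinearRHS G q σ μ u x) : UpperEstimateAt C G q σ μ u x := by
  have : (ae σ).NeBot := ae_neBot.2 hσ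
  obtain ⟨x₀, hx₀⟩ := hu.rhs_lt_top.exists
  exact hx.trans ((hG.sublinearRHS_le hκ hq0 hq1 hu.le_rhs hx₀ x).trans (by gcongr))

/-- The existence of a supersolution implies the tail conditions. -/
lemma tailConditions_of_supersolution [SFinite μ] (hG : IsQuasiMetricKernel G κ) (hκ : 1 ≤ κ) (hq0 : 0 < q)
    (hq1 : q < 1) (hσ : σ ≠ 0) {c : ℝ≥0} (hc0 : 0 < c)
    {u : Ω → ℝ≥0∞} (hu : IsNontrivialSupersolution G q σ μ u)
    (hlow : ∀ x, sublinearRHS G q σ μ u x ≤ u x → LowerEstimateAt c G q σ μ u x)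
    (x : Ω) {a : ℝ} (ha : 0 < a) : TailConditions G q σ μ x a := by
  have hq1' : 0 < 1 - q := by linarith
  have : (ae σ).NeBot := ae_neBot.2 hσ
  obtain ⟨x₀, hx₀, hlt⟩ := (hu.rhs_le.and hu.lt_top).exists
  have hfin := (hlow x₀ hx₀).trans_lt hlt
  obtain ⟨h1, hμ⟩ := ENNReal.add_lt_top.1 hfin
  have hcne : (c : ℝ≥0∞) ≠ 0 := by exact_mod_cast hc0.ne'
  have h2 : kernelPotential G σ x₀ ^ (1 / (1 - q)) + intrinsicPotential G q σ x₀ ≠ ∞ :=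
    fun h => by rw [h, ENNReal.mul_top hcne] at h1; exact lt_irrefl _ h1
  obtain ⟨h3, h4⟩ := ENNReal.add_ne_top.1 h2
  have h5 : kernelPotential G σ x₀ ≠ ∞ := fun h => by
    rw [h, ENNReal.top_rpow_of_pos (by positivity)] at h3; exact h3 rfl
  -- At `x₀` the three potentials are finite, which is the tail condition with lower limit `0`.
  refine hG.tailConditions_of_tailConditions hκ hq0 hq1 (x₀ := x₀) le_rfl ?_ x ha
  rw [TailConditions.iff_tailIntegral, ← hG.kernelPotential_eq_tailIntegral,
    ← hG.kernelPotential_eq_tailIntegral]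
  exact ⟨h5.lt_top, h4.lt_top, hμ⟩

end IsQuasiMetricKernel

/-- Both estimates involve the same data. The summand `1` makes the constant at least 1, as the
comparison argument requires. -/
lemma UpperEstimateAt.le_mul_of_lowerEstimateAt {Ω : Type*} [TopologicalSpace Ω]
    [MeasurableSpace Ω] {G : Ω → Ω → ℝ≥0∞} {q : ℝ} {σ μ : Measure Ω} {c C : ℝ≥0} (hc : 0 < c)
    {u v : Ω → ℝ≥0∞} {x : Ω} (hu : UpperEstimateAt C G q σ μ u x)
    (hv : LowerEstimateAt c G q σ μ v x) : u x ≤ ((1 + C + C * c⁻¹ : ℝ≥0) : ℝ≥0∞) * v x := by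
  unfold UpperEstimateAt at hu
  unfold LowerEstimateAt at hv
  set a := kernelPotential G σ x ^ (1 / (1 - q)) + intrinsicPotential G q σ x
  set b := kernelPotential G μ x
  have hcc : ((c⁻¹ : ℝ≥0) : ℝ≥0∞) * c = 1 := by
    rw [← ENNReal.coe_mul, inv_mul_cancel₀ hc.ne', ENNReal.coe_one]
  have ha : a ≤ (c⁻¹ : ℝ≥0) * v x :=
    calc a = (c⁻¹ : ℝ≥0) * (c * a) := by rw [← mul_assoc, hcc, one_mul]
      _ ≤ _ := by gcongr; exact le_self_add.trans hv
  have hb : b ≤ v x := le_add_self.trans hv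
  calc u x ≤ C * (a + b) := hu
    _ ≤ C * ((c⁻¹ : ℝ≥0) * v x + v x) := by gcongr
    _ ≤ 1 * v x + C * ((c⁻¹ : ℝ≥0) * v x + v x) := le_add_self
    _ = _ := by push_cast; ring

theorem theorem1p1 (q : ℝ) (hq0 : 0 < q) (hq1 : q < 1) (κ : ℝ≥0) (hκ : 0 < κ) :
    ∃ c C : ℝ≥0, 0 < c ∧ 0 < C ∧
      ∀ (Ω : Type*) [TopologicalSpace Ω] [LocallyCompactSpace Ω] [T2Space Ω]
        [SecondCountableTopology Ω] [MeasurableSpace Ω] [BorelSpace Ω]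
        (G : Ω → Ω → ℝ≥0∞) (_ : IsQuasiMetricKernel G κ)
        (μ σ : Measure Ω) [IsLocallyFiniteMeasure μ] [IsLocallyFiniteMeasure σ] (_ : σ ≠ 0),
        -- (i) bilateral estimates almost everywhere, and uniqueness
        ((∀ u : Ω → ℝ≥0∞, IsNontrivialSolution G q σ μ u →
            ∀ᵐ x ∂σ, LowerEstimateAt c G q σ μ u x ∧ UpperEstimateAt C G q σ μ u x) ∧
          (∀ u v : Ω → ℝ≥0∞, IsNontrivialSolution G q σ μ u → IsNontrivialSolution G q σ μ v →
            u =ᵐ[σ] v)) ∧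
        -- (ii) pointwise estimates of supersolutions and subsolutions
        ((∀ u : Ω → ℝ≥0∞, IsNontrivialSupersolution G q σ μ u →
            ∀ x, sublinearRHS G q σ μ u x ≤ u x → LowerEstimateAt c G q σ μ u x) ∧
          (∀ u : Ω → ℝ≥0∞, IsSubsolution G q σ μ u →
            ∀ x, u x ≤ sublinearRHS G q σ μ u x → UpperEstimateAt C G q σ μ u x)) ∧
        -- (iii) existence, and pointwise estimates of solutions
        (List.TFAE [
            ∃ u : Ω → ℝ≥0∞, IsNontrivialSolution G q σ μ u,
            ∃ u : Ω → ℝ≥0∞, IsNontrivialSupersolution G q σ μ u,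
            ∃ (x₀ : Ω) (a : ℝ), 0 < a ∧ TailConditions G q σ μ x₀ a,
            ∀ (x₀ : Ω) (a : ℝ), 0 < a → TailConditions G q σ μ x₀ a] ∧
          (∀ u : Ω → ℝ≥0∞, IsNontrivialSolution G q σ μ u →
            ∀ x, u x = sublinearRHS G q σ μ u x →
              LowerEstimateAt c G q σ μ u x ∧ UpperEstimateAt C G q σ μ u x)) := by
  have hq1' : 0 < 1 - q := by linarith
  -- Enlarging the constant keeps the kernel quasi-metric and gives the bound `1 ≤ κ'` used
  -- throughout.
  set κ' := max κ 1 with hκ'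
  have h1κ : 1 ≤ κ' := le_max_right _ _
  set L := (ENNReal.ofReal (2 * κ') ^ q * ENNReal.ofReal (1 / (1 - q))) ^ (1 / (1 - q))
    + (ENNReal.ofReal (1 / (1 - q)) ^ (1 / q) * ENNReal.ofReal (3 * κ')) ^ (q / (1 - q)) with hL
  set M := 2 * ENNReal.ofReal (8 * κ') ^ (q / (1 - q)) with hM
  have hLtop : L ≠ ∞ := by
    refine ENNReal.add_ne_top.2 ⟨ENNReal.rpow_ne_top_of_nonneg (by positivity)
      (ENNReal.mul_ne_top ?_ ENNReal.ofReal_ne_top), ENNReal.rpow_ne_top_of_nonneg (by positivity)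
      (ENNReal.mul_ne_top ?_ ENNReal.ofReal_ne_top)⟩
    · exact ENNReal.rpow_ne_top_of_nonneg hq0.le ENNReal.ofReal_ne_top
    · exact ENNReal.rpow_ne_top_of_nonneg (by positivity) ENNReal.ofReal_ne_top
  have hMtop : M ≠ ∞ := ENNReal.mul_ne_top ENNReal.ofNat_ne_top
    (ENNReal.rpow_ne_top_of_nonneg (by positivity) ENNReal.ofReal_ne_top)
  set c : ℝ≥0 := (L.toNNReal + 1)⁻¹ with hc
  set C : ℝ≥0 := M.toNNReal + 1 with hC
  have hc0 : 0 < c := by positivity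
  have hcL : (c : ℝ≥0∞) * L ≤ 1 := by
    rw [← ENNReal.coe_toNNReal hLtop, ← ENNReal.coe_mul]
    have : c * L.toNNReal ≤ 1 := by
      rw [hc, inv_mul_le_iff₀ (by positivity), mul_one]
      exact le_self_add
    exact_mod_cast this
  have hMC : M ≤ (C : ℝ≥0∞) := by
    rw [← ENNReal.coe_toNNReal hMtop]
    exact_mod_cast le_self_add
  refine ⟨c, C, hc0, by positivity, ?_⟩
  intro Ω _ _ _ _ _ _ G hG₀ μ σ _ _ hσ
  have hG : IsQuasiMetricKernel G κ' := hG₀.mono (le_max_left _ _)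
  have hlow : ∀ u : Ω → ℝ≥0∞, IsNontrivialSupersolution G q σ μ u →
      ∀ x, sublinearRHS G q σ μ u x ≤ u x → LowerEstimateAt c G q σ μ u x :=
    fun u hu x hx => hG.lowerEstimateAt h1κ hq0 hq1 hcL hu hx
  have hup : ∀ u : Ω → ℝ≥0∞, IsSubsolution G q σ μ u →
      ∀ x, u x ≤ sublinearRHS G q σ μ u x → UpperEstimateAt C G q σ μ u x :=
    fun u hu x hx => hG.upperEstimateAt h1κ hq0 hq1 hσ hMC hu hx
  have hboth : ∀ u : Ω → ℝ≥0∞, IsNontrivialSolution G q σ μ u →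
      ∀ᵐ x ∂σ, LowerEstimateAt c G q σ μ u x ∧ UpperEstimateAt C G q σ μ u x := by
    intro u hu
    filter_upwards [hu.1.le_rhs, hu.2.rhs_le] with x h1 h2
    exact ⟨hlow u hu.2 x h2, hup u hu.1 x h1⟩
  have hle : ∀ u v : Ω → ℝ≥0∞, IsNontrivialSolution G q σ μ u → IsNontrivialSolution G q σ μ v →
      ∀ᵐ x ∂σ, u x ≤ v x := by
    intro u v hu hv
    refine ae_le_of_ae_le_const_mul hq0 hq1 hu.1.le_rhs hv.2.rhs_le (K := 1 + C + C * c⁻¹)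
      (by rw [add_assoc]; exact le_self_add) ?_
    filter_upwards [hboth u hu, hboth v hv] with x h1 h2
    exact h1.2.le_mul_of_lowerEstimateAt hc0 h2.1
  refine ⟨⟨hboth, fun u v hu hv => ?_⟩, ⟨hlow, hup⟩, ?_, fun u hu x hx =>
    ⟨hlow u hu.2 x hx.ge, hup u hu.1 x hx.le⟩⟩
  · filter_upwards [hle u v hu hv, hle v u hv hu] with x h1 h2 using le_antisymm h1 h2
  · tfae_have 1 → 2 := fun ⟨u, hu⟩ => ⟨u, hu.2⟩
    tfae_have 2 → 4 := fun ⟨u, hu⟩ x a ha =>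
      hG.tailConditions_of_supersolution h1κ hq0 hq1 hσ hc0 hu (hlow u hu) x ha
    tfae_have 4 → 1 := fun h => hG.exists_solution h1κ hq0 hq1 hσ h
    tfae_have 3 → 4 := fun ⟨x₀, a₀, ha₀, h⟩ x a ha =>
      hG.tailConditions_of_tailConditions h1κ hq0 hq1 ha₀.le h x ha
    tfae_have 4 → 3 := fun h => by
      have : (ae σ).NeBot := ae_neBot.2 hσ
      obtain ⟨x₀, -⟩ := (Filter.Eventually.of_forall (f := ae σ) fun _ => trivial).exists
      exact ⟨x₀, 1, one_pos, h x₀ 1 one_pos⟩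
    tfae_finish
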